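/- Let $V=\{A\in\mathfrak{gl}(3,\mathbb C)\mid A^\top=A,\ \operatorname{Tr}A=0\}$, regarded as a real vector space and identified with its dual by $\langle A,B\rangle=\operatorname{Re}\operatorname{Tr}(A^*B)$, and let $G=U(1)\times SO(3)$ act on $V$ by $A\mapsto e^{i\varphi}RAR^{-1}$. Write $\widehat{\mathbf w}\mathbf x=\mathbf w\times\mathbf x$; the Lie algebra of $G$ is $\mathbb R\times\mathbb R^3$, and $\xi=(v,\mathbf w)$ acts on $V$ by $\xi A=ivA+[\widehat{\mathbf w},A]$. Let $S=G\ltimes V$, with Lie algebra $\mathfrak s$. Its coadjoint action on $\mathfrak s^*=\mathbb R\times\mathbb R^3\times V\ni(p,\mathbf m,A)$ is $$(e^{i\varphi},R,U)\cdot(p,\mathbf m,A)=\big((p,R\mathbf m)+U\diamond A',\,A'\big),\qquad A'=e^{i\varphi}RAR^{-1},\qquad \langle U\diamond A,\xi\rangle=\langle A,\xi U\rangle .$$ Let $A_0=\operatorname{diag}(1,1,-2)$ (the $\Omega_1$-phase), and let $\mathcal O=\mathcal O_{(p,\mathbf m,A_0)}$ be the coadjoint orbit through $(p,\mathbf m,A_0)$,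 with its (minus) orbit symplectic form, $\omega_z(\zeta_{\mathfrak s^*}(z),\eta_{\mathfrak s^*}(z))=-\langle z,[\zeta,\eta]\rangle$. Let $\gamma_1,\gamma_2,\gamma_3>0$, $\Gamma=\operatorname{diag}(\gamma_1,\gamma_1,\gamma_1+\gamma_2+\gamma_3)$, $\langle\langle A,B\rangle\rangle=\operatorname{Re}\operatorname{Tr}(\Gamma A^*B)$, and consider the Lagrangian $l(v,\mathbf w,A)=\langle\langle \xi A,\xi A\rangle\rangle$, $\xi=(v,\mathbf w)$. For $A$ in the $G$-orbit of $A_0$ let $\mathfrak g_A=\{\xi\mid \xi A=0\}$, and let $\mathfrak g_A^\perp$ be its orthogonal complement in $\mathbb R\times\mathbb R^3$ for the standard inner product. For every $z=(p',\mathbf m',A)\in\mathcal O$ there is a unique $\xi=(v,\mathbf w)\in\mathfrak g_A^\perp$, the velocity at $z$, such that the differential of $l(\cdot,A)$ at $\xi$ and the functional $(p',\mathbf m')$ agree on $\mathfrak g_A^\perp$. (If $(p',\mathbf m')$ vanishes on $\mathfrak g_A$ this is the Legendre transformation $p'=\delta l/\delta v$, $\mathbf m'=\delta l/\delta\mathbf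 w$. In general, $(p',\mathbf m')$ is replaced by the covector at $A$ of the $G$-orbit of $A_0$ that it defines through the horizontal lift.) With this velocity define on $\mathcal O$ $$h(p',\mathbf m',A)=p'v+\mathbf m'\cdot\mathbf w-l(v,\mathbf w,A),\qquad j_m(p',\mathbf m',A)=2\langle (\xi A)\Gamma,iA\rangle,\qquad \mathbf J_3(p',\mathbf m',A)=\mathbf e_3\cdot\mathbf m'.$$ **Theorem.** For all $p\in\mathbb R$ and $\mathbf m\in\mathbb R^3$ the three functions $h,j_m,\mathbf J_3$ form a completely integrable system on $\mathcal O_{(p,\mathbf m,A_0)}$. That is, $\mathcal O_{(p,\mathbf m,A_0)}$ has dimension six; $h,j_m,\mathbf J_3$ are well defined and smooth on it; their pairwise Poisson brackets with respect to the orbit symplectic form vanish; and their differentials are linearly independent at all points of an open dense subset of $\mathcal O_{(p,\mathbf m,A_0)}$ whose complement has measure zero. -/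

import Mathlib

open scoped Matrix ContDiff

attribute [local instance] Matrix.normedAddCommGroup Matrix.normedSpace

namespace NeutronStar

/-! ### The group `U(1) × SO(3)` acting on traceless symmetric complex matrices -/

/-- Complex `3 × 3` matrices. -/
abbrev Mat3 := Matrix (Fin 3) (Fin 3) ℂ

/-- The real vector space of symmetric traceless complex `3 × 3` matrices. -/
noncomputable def symTraceless : Submodule ℝ Mat3 where
  carrier := {A | Aᵀ = A ∧ A.trace = 0}
  add_mem' := by
    rintro A B ⟨hA, hA'⟩ ⟨hB, hB'⟩
    exact ⟨by rw [Matrix.transpose_add, hA, hB], by rw [Matrix.trace_add, hA', hB', add_zero]⟩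
  zero_mem' := ⟨Matrix.transpose_zero, Matrix.trace_zero _ _⟩
  smul_mem' := by
    rintro c A ⟨hA, hA'⟩
    exact ⟨by rw [Matrix.transpose_smul, hA], by rw [Matrix.trace_smul, hA', smul_zero]⟩

/-- A real matrix regarded as a complex one. -/
noncomputable def toComplex (R : Matrix (Fin 3) (Fin 3) ℝ) : Mat3 := R.map Complex.ofReal

/-- The action `A ↦ u R A R⁻¹` of `(u, R) ∈ U(1) × SO(3)`; note `R⁻¹ = Rᵀ`. -/
noncomputable def groupAct (u : Circle) (R : Matrix.specialOrthogonalGroup (Fin 3) ℝ) (A : Mat3) : Mat3 :=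
  (u : ℂ) • (toComplex R.1 * A * toComplex R.1ᵀ)

/-- The hat map `ℝ³ ≃ 𝔰𝔬(3)`, `hat w x = w × x`. -/
def hat (w : Fin 3 → ℝ) : Matrix (Fin 3) (Fin 3) ℝ :=
  !![0, -w 2, w 1; w 2, 0, -w 0; -w 1, w 0, 0]

/-- The infinitesimal generator `i v A + [ŵ, A]` of `(v, w) ∈ ℝ × ℝ³ ≃ 𝔲(1) × 𝔰𝔬(3)` at `A`. -/
noncomputable def infAct (ξ : ℝ × (Fin 3 → ℝ)) (A : Mat3) : Mat3 :=
  (Complex.I * (ξ.1 : ℂ)) • A + (toComplex (hat ξ.2) * A - A * toComplex (hat ξ.2))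

/-- The real inner product `⟨A, B⟩ = Re Tr (A* B)`, used to identify the space of symmetric
traceless matrices with its dual. -/
noncomputable def matPair (A B : Mat3) : ℝ := (Aᴴ * B).trace.re

/-- The `a`-th standard basis vector of `ℝ³`. -/
def basisVec (a : Fin 3) : Fin 3 → ℝ := Pi.single a 1

/-- The diamond operation `U ⋄ A ∈ (𝔲(1) × 𝔰𝔬(3))* ≃ ℝ × ℝ³`, defined by
`⟨U ⋄ A, ξ⟩ = ⟨A, ξ U⟩`. -/
noncomputable def diamond (U A : Mat3) : ℝ × (Fin 3 → ℝ) :=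
  (matPair A (infAct (1, 0) U), fun a => matPair A (infAct (0, basisVec a) U))

/-! ### The semidirect product, its coadjoint orbits, the orbit symplectic form

Let `V` be the space of symmetric traceless matrices and `𝔰 = (𝔲(1) × 𝔰𝔬(3)) ⋉ V`. An element
`(v, w, U)` of `𝔰`, as well as an element `(p, m, A)` of the dual `𝔰*`, is a triple
in `ℝ × ℝ³ × Mat3` whose last component lies in `V`. -/

/-- Triples `(p, m, A)`. -/
abbrev Triple := ℝ × (Fin 3 → ℝ) × Mat3

/-- The Lie algebra `𝔰`, as a space of triples. -/
noncomputable def lieAlg : Submodule ℝ Triple :=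
  Submodule.prod ⊤ (Submodule.prod ⊤ symTraceless)

/-- The duality pairing between `𝔰*` and `𝔰`. -/
noncomputable def pairing (z ζ : Triple) : ℝ := z.1 * ζ.1 + z.2.1 ⬝ᵥ ζ.2.1 + matPair z.2.2 ζ.2.2

/-- The Lie bracket of `𝔰`. -/
noncomputable def lieBracket (ζ η : Triple) : Triple :=
  (0, crossProduct ζ.2.1 η.2.1,
    infAct (ζ.1, ζ.2.1) η.2.2 - infAct (η.1, η.2.1) ζ.2.2)

/-- The coadjoint action of `(u, R, U) ∈ (U(1) × SO(3)) ⋉ V` on `𝔰*`: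
`(μ, A) ↦ (Ad* μ + U ⋄ gA, gA)`, `g = (u, R)`. -/
noncomputable def coadAct (u : Circle) (R : Matrix.specialOrthogonalGroup (Fin 3) ℝ) (U : Mat3)
    (z : Triple) : Triple :=
  (z.1 + (diamond U (groupAct u R z.2.2)).1,
    R.1 *ᵥ z.2.1 + (diamond U (groupAct u R z.2.2)).2,
    groupAct u R z.2.2)

/-- The coadjoint orbit through `z₀`. -/
def coadOrbit (z₀ : Triple) : Set Triple :=
  {z | ∃ (u : Circle) (R : Matrix.specialOrthogonalGroup (Fin 3) ℝ), ∃ U ∈ symTraceless,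
    z = coadAct u R U z₀}

/-- The infinitesimal generator of the coadjoint action given by `ζ = (v, w, U)`, at
`z = (p, m, A)`; it is characterized by `⟨ζ_{𝔰*}(z), η⟩ = -⟨z, [ζ, η]⟩`. -/
noncomputable def coadVec (ζ z : Triple) : Triple :=
  ((diamond ζ.2.2 z.2.2).1,
    crossProduct ζ.2.1 z.2.1 + (diamond ζ.2.2 z.2.2).2,
    infAct (ζ.1, ζ.2.1) z.2.2)

/-- The tangent space at `z` of the coadjoint orbit through `z`. -/
noncomputable def orbitTangent (z : Triple) : Submodule ℝ Triple :=
  Submodule.span ℝ ((fun ζ => coadVec ζ z) '' (lieAlg : Set Triple))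

/-- The (minus) orbit symplectic form at `z`, on the tangent vectors generated by `ζ` and `η`.
(The opposite sign convention changes all Hamiltonian vector fields by a sign.) -/
noncomputable def orbitForm (z ζ η : Triple) : ℝ := -pairing z (lieBracket ζ η)

/-- The differential at `z` of a function `f` on the orbit `O`, evaluated on the tangent vector
generated by `ζ`. A derivative of `f` within `O` is unique on vectors tangent to `O`. -/
noncomputable def orbitDiff (O : Set Triple) (f : Triple → ℝ) (z ζ : Triple) : ℝ :=
  fderivWithin ℝ f O z (coadVec ζ z)

/-- The Hamiltonian vector field of `f` on the orbit `O` has at `z` the value generated by `ζ`. -/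
def IsHamiltonianAt (O : Set Triple) (f : Triple → ℝ) (z ζ : Triple) : Prop :=
  ζ ∈ lieAlg ∧ ∀ η ∈ lieAlg, orbitForm z ζ η = orbitDiff O f z η

/-- The value at `z` of the Poisson bracket of `f` and `g` on the symplectic manifold `O` is `c`,
that is, `c = ω(X_f, X_g)`. -/
def IsPoissonBracketAt (O : Set Triple) (f g : Triple → ℝ) (z : Triple) (c : ℝ) : Prop :=
  ∃ ζ η, IsHamiltonianAt O f z ζ ∧ IsHamiltonianAt O g z η ∧ orbitForm z ζ η = c

/-- `d`-dimensional Hausdorff measure on the space of triples. On an embedded submanifold of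
dimension `d` its null sets are the null sets of any smooth volume. -/
noncomputable def hausdorffVolume (d : ℝ) : Set Triple → ENNReal := fun S =>
  letI : MeasurableSpace Triple :=
    @borel Triple PseudoEMetricSpace.toUniformSpace.toTopologicalSpace
  haveI : @BorelSpace Triple PseudoEMetricSpace.toUniformSpace.toTopologicalSpace _ := ⟨rfl⟩
  MeasureTheory.Measure.hausdorffMeasure d S

/-- The functions `f 0, …, f (n - 1)` form a completely integrable system on the coadjoint
orbit `O`. -/
structure IsCompletelyIntegrable {n : ℕ} (O : Set Triple) (f : Fin n → Triple → ℝ) : Prop where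
  /-- The number of functions is half the dimension of the orbit. -/
  dim : ∀ z ∈ O, Module.finrank ℝ (orbitTangent z) = 2 * n
  /-- The functions are smooth on the orbit. -/
  smooth : ∀ i, ContDiffOn ℝ ∞ (f i) O
  /-- The functions are pairwise in involution. -/
  involution : ∀ i j, ∀ z ∈ O, IsPoissonBracketAt O (f i) (f j) z 0
  /-- The differentials are linearly independent on a (relatively) open dense subset of the orbit
  whose complement in the orbit has measure zero. -/
  independent : ∃ W : Set Triple, IsOpen W ∧ O ⊆ closure (O ∩ W) ∧
    hausdorffVolume (2 * n) (O \ W) = 0 ∧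
    ∀ z ∈ O ∩ W, ∀ c : Fin n → ℝ,
      (∀ ζ ∈ lieAlg, ∑ i, c i * orbitDiff O (f i) z ζ = 0) → c = 0

/-! ### The `Ω₁`-phase -/

/-- The base point of the `Ω₁`-phase. -/
def baseMat : Mat3 := Matrix.diagonal ![1, 1, -2]

/-- The inner product `⟪A, B⟫ = Re Tr (Γ A* B)` with `Γ = diag(γ₁, γ₁, γ₁ + γ₂ + γ₃)`. -/
noncomputable def gammaPair (γ : Fin 3 → ℝ) (A B : Mat3) : ℝ :=
  (toComplex (Matrix.diagonal ![γ 0, γ 0, γ 0 + γ 1 + γ 2]) * Aᴴ * B).trace.re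

/-- The reduced Lagrangian `l(ξ, A) = ⟪ξ_M(A), ξ_M(A)⟫`, where `ξ = (v, w)` and
`ξ_M(A) = i v A + [ŵ, A]`. -/
noncomputable def lagrangian (γ : Fin 3 → ℝ) (ξ : ℝ × (Fin 3 → ℝ)) (A : Mat3) : ℝ :=
  gammaPair γ (infAct ξ A) (infAct ξ A)

/-- The elements of `ℝ × ℝ³` orthogonal (for the standard, `Ad`-invariant, inner product) to
the isotropy Lie algebra of `A`. By `ξ ↦ ξ_M(A)` they correspond to the tangent vectors at `A`
of the `U(1) × SO(3)`-orbit of `A`. -/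
def IsHorizontal (A : Mat3) (ξ : ℝ × (Fin 3 → ℝ)) : Prop :=
  ∀ κ : ℝ × (Fin 3 → ℝ), infAct κ A = 0 → κ.1 * ξ.1 + κ.2 ⬝ᵥ ξ.2 = 0

/-- `ξ` is the reduced velocity corresponding to `z = (p, m, A)` by the Legendre transformation
`p = δl/δv`, `m = δl/δw`. The Lagrangian is constant in the directions of the isotropy Lie algebra
of `A`, and so the velocity is taken horizontal and the momentum `(p, m)` is restricted to
horizontal directions, i.e. `(p, m)` is replaced by the covector at `A` of the configuration
space which it defines by means of the horizontal lift. -/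
def IsVelocity (γ : Fin 3 → ℝ) (z : Triple) (ξ : ℝ × (Fin 3 → ℝ)) : Prop :=
  IsHorizontal z.2.2 ξ ∧ ∀ η, IsHorizontal z.2.2 η →
    HasDerivAt (fun t : ℝ => lagrangian γ (ξ + t • η) z.2.2) (z.1 * η.1 + z.2.1 ⬝ᵥ η.2) 0

open Classical in
/-- The reduced velocity corresponding to `z`. -/
noncomputable def velocity (γ : Fin 3 → ℝ) (z : Triple) : ℝ × (Fin 3 → ℝ) :=
  if h : ∃ ξ, IsVelocity γ z ξ then h.choose else 0

/-- The Hamiltonian `h = p v + m · w - l(v, w, A)` associated to `l`. -/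
noncomputable def hamiltonian (γ : Fin 3 → ℝ) (z : Triple) : ℝ :=
  z.1 * (velocity γ z).1 + z.2.1 ⬝ᵥ (velocity γ z).2 - lagrangian γ (velocity γ z) z.2.2

/-- The momentum map `j_m = 2 ⟨(∂_z A) Γ, i A⟩` of the circle action `A ↦ e^{iφ} A`, where
`∂_z A = i v A + [ŵ, A]`. -/
noncomputable def circleMomentum (γ : Fin 3 → ℝ) (z : Triple) : ℝ :=
  2 * gammaPair γ (infAct (velocity γ z) z.2.2) (Complex.I • z.2.2)

/-- The function `J₃ = e₃ · m`. -/
def rotationMomentum (z : Triple) : ℝ := basisVec 2 ⬝ᵥ z.2.1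

end NeutronStar

namespace NeutronStar

/-! ### Linear algebra of the infinitesimal action -/

/-! Write e₃ for `basisVec 2`, n₃ for `n 2`, g for `γ 0` and d for `γ 1 + γ 2`. The G-orbit of the
base point consists of the uniaxial matrices A = u(1 - 3nnᵀ) with |n| = 1, whose isotropy algebra is
spanned by (0, n). Translations U change the momentum by any covector that annihilates this algebra.
Hence the coadjoint orbit is cut out by m'·n = m₃, with u, n and p' free (`mem_coadOrbit_iff`), and
its tangent spaces have dimension 6.

In these variables everything is explicit. With ν = w × n, the tangent vector of the sphere, the
Lagrangian is a v² + 9(b|ν|² + dν₃²), where a = 6g + d(1 + 3n₃²) and b = 2g + dn₃². This is positive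
definite on horizontal vectors, so the velocity is the solution of a linear system. It gives j_m =
p' (`circleMomentum_eq`), and h as a function of p', |m'|², n₃², k² and the constant m'·n, where k =
(m' × n)₃ (`hamiltonian_eq`). This expression is even in n and has positive denominators. The
products nᵢnⱼ are polynomials in A, so h is smooth on the orbit.

The functions j_m and J₃ are restrictions of linear functions on 𝔰*, so up to sign their Hamiltonian
vectors are the constant generators (1, 0, 0) and (0, e₃, 0). Brackets with them are derivatives
along phase rotations and rotations about e₃. These preserve h, and rotations about e₃ preserve p',
so all brackets vanish.

For independence, vary only the momentum. The direction n × e₃ leaves p' and m'₃ fixed and changes h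
at the rate k/(18(2g + d)). The directions δp' = 1 and δm' = e₃ - n₃n then separate j_m and J₃
(`differentials_independent`). So the differentials are independent wherever k ≠ 0. The zero set of
k is nowhere dense in the orbit and is covered by C¹ images of ℝ⁵ and ℝ⁴, so its 6-dimensional
Hausdorff measure is zero. -/

theorem matPair_eq (A B : Mat3) :
    matPair A B = ∑ i, ∑ j, ((A j i).re * (B j i).re + (A j i).im * (B j i).im) := by
  simp [matPair, Matrix.trace, Matrix.mul_apply, Complex.mul_re]

theorem matPair_self_eq_zero {A : Mat3} (h : matPair A A = 0) : A = 0 := by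
  rw [matPair_eq, Finset.sum_eq_zero_iff_of_nonneg
    fun i _ => Finset.sum_nonneg fun j _ => by nlinarith [sq_nonneg (A j i).re, sq_nonneg (A j i).im]] at h
  ext i j
  have h1 := h j (Finset.mem_univ _)
  rw [Finset.sum_eq_zero_iff_of_nonneg
    fun j' _ => by nlinarith [sq_nonneg (A j' j).re, sq_nonneg (A j' j).im]] at h1
  have h2 := h1 i (Finset.mem_univ _)
  apply Complex.ext <;> simp <;> nlinarith [sq_nonneg (A i j).re, sq_nonneg (A i j).im]

theorem matPair_self_nonneg (A : Mat3) : 0 ≤ matPair A A := by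
  rw [matPair_eq]
  exact Finset.sum_nonneg fun i _ => Finset.sum_nonneg fun j _ => by
    nlinarith [sq_nonneg (A j i).re, sq_nonneg (A j i).im]

theorem matPair_add_left (A B C : Mat3) : matPair (A + B) C = matPair A C + matPair B C := by
  simp [matPair, Matrix.add_mul]

theorem matPair_add_right (A B C : Mat3) : matPair A (B + C) = matPair A B + matPair A C := by
  simp [matPair, Matrix.mul_add]

theorem matPair_sub_right (A B C : Mat3) : matPair A (B - C) = matPair A B - matPair A C := by
  simp [matPair, Matrix.mul_sub]

theorem matPair_smul_left (c : ℝ) (A B : Mat3) : matPair (c • A) B = c * matPair A B := by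
  simp [matPair]

theorem matPair_smul_right (c : ℝ) (A B : Mat3) : matPair A (c • B) = c * matPair A B := by
  simp [matPair]

theorem matPair_zero_right (A : Mat3) : matPair A 0 = 0 := by
  simp [matPair]

theorem toComplex_hat_conjTranspose (w : Fin 3 → ℝ) :
    (toComplex (hat w))ᴴ = -toComplex (hat w) := by
  ext i j
  fin_cases i <;> fin_cases j <;> simp [toComplex, hat]

/-- The infinitesimal action is skew-adjoint. -/
theorem matPair_infAct (ξ : ℝ × (Fin 3 → ℝ)) (A B : Mat3) :
    matPair A (infAct ξ B) = -matPair (infAct ξ A) B := by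
  simp only [matPair, infAct, Matrix.conjTranspose_add, Matrix.conjTranspose_sub,
    Matrix.conjTranspose_smul, Matrix.conjTranspose_mul, toComplex_hat_conjTranspose,
    Matrix.mul_add, Matrix.add_mul, Matrix.mul_sub, Matrix.sub_mul, Matrix.trace_add,
    Matrix.trace_sub, ← Complex.neg_re, Matrix.mul_neg, Matrix.neg_mul, Matrix.trace_neg,
    Matrix.smul_mul, Matrix.mul_smul, Matrix.trace_smul]
  congr 1
  rw [Matrix.mul_assoc (toComplex _) Aᴴ B, Matrix.trace_mul_comm (toComplex _) (Aᴴ * B)]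
  simp [Matrix.mul_assoc]
  ring

theorem infAct_add_left (ξ η : ℝ × (Fin 3 → ℝ)) (A : Mat3) :
    infAct (ξ + η) A = infAct ξ A + infAct η A := by
  have : toComplex (hat (ξ.2 + η.2)) = toComplex (hat ξ.2) + toComplex (hat η.2) := by
    ext i j
    fin_cases i <;> fin_cases j <;> simp [toComplex, hat] <;> ring
  simp only [infAct, Prod.fst_add, Prod.snd_add, this, Complex.ofReal_add, mul_add, add_smul,
    Matrix.add_mul]
  abel

theorem infAct_smul_left (c : ℝ) (ξ : ℝ × (Fin 3 → ℝ)) (A : Mat3) :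
    infAct (c • ξ) A = c • infAct ξ A := by
  ext i j
  fin_cases i <;> fin_cases j <;>
    simp [infAct, toComplex, hat, Matrix.mul_apply, Fin.sum_univ_three] <;> ring

theorem infAct_zero_right (ξ : ℝ × (Fin 3 → ℝ)) : infAct ξ 0 = 0 := by
  simp [infAct]

theorem infAct_mem {A : Mat3} (hA : A ∈ symTraceless) (ξ : ℝ × (Fin 3 → ℝ)) :
    infAct ξ A ∈ symTraceless := by
  obtain ⟨h1, h2⟩ := hA
  have hw : (toComplex (hat ξ.2))ᵀ = -toComplex (hat ξ.2) := by
    ext i j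
    fin_cases i <;> fin_cases j <;> simp [toComplex, hat]
  refine ⟨?_, ?_⟩
  · simp only [infAct, Matrix.transpose_add, Matrix.transpose_sub, Matrix.transpose_mul, h1, hw,
      Matrix.transpose_smul, Matrix.mul_neg, Matrix.neg_mul]
    abel
  · simp [infAct, h2, Matrix.trace_mul_comm A]

theorem diamond_pair (U A : Mat3) (ξ : ℝ × (Fin 3 → ℝ)) :
    (diamond U A).1 * ξ.1 + (diamond U A).2 ⬝ᵥ ξ.2 = matPair A (infAct ξ U) := by
  have h : ξ = ξ.1 • (1, 0) + (ξ.2 0 • (0, basisVec 0) + (ξ.2 1 • (0, basisVec 1) +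
      ξ.2 2 • (0, basisVec 2))) := by
    ext i
    · simp
    · fin_cases i <;> simp [basisVec]
  conv_rhs => rw [h]
  simp only [infAct_add_left, infAct_smul_left, matPair_add_right, matPair_smul_right]
  simp [diamond, dotProduct, Fin.sum_univ_three]
  ring

theorem diamond_zero (A : Mat3) : diamond 0 A = 0 := by
  ext <;> simp [diamond, infAct_zero_right, matPair_zero_right]

/-! ### The orbit form -/

theorem mem_lieAlg {ζ : Triple} : ζ ∈ lieAlg ↔ ζ.2.2 ∈ symTraceless := by
  simp [lieAlg, Submodule.mem_prod]

/-- This is the defining property of the coadjoint generator: the U-part of the bracket is handled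
by the diamond identity and skew-adjointness, the rotation part by the triple product. -/
theorem orbitForm_eq_pairing (z ζ η : Triple) :
    orbitForm z ζ η = pairing (coadVec ζ z) η := by
  have h1 := diamond_pair ζ.2.2 z.2.2 (η.1, η.2.1)
  have h2 := matPair_infAct (ζ.1, ζ.2.1) z.2.2 η.2.2
  simp only [orbitForm, pairing, lieBracket, coadVec, add_dotProduct, matPair_sub_right] at *
  rw [← h1, h2]
  have : crossProduct ζ.2.1 z.2.1 ⬝ᵥ η.2.1 = -(z.2.1 ⬝ᵥ crossProduct ζ.2.1 η.2.1) := by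
    simp [cross_apply, dotProduct, Fin.sum_univ_three]
    ring
  rw [this]
  ring

theorem orbitForm_swap (z ζ η : Triple) : orbitForm z ζ η = -orbitForm z η ζ := by
  have : lieBracket ζ η = -lieBracket η ζ := by
    simp only [lieBracket, Prod.neg_mk, neg_zero, neg_sub, cross_anticomm]
  rw [orbitForm, orbitForm, this]
  simp [pairing, matPair]
  ring

theorem orbitForm_self (z ζ : Triple) : orbitForm z ζ ζ = 0 := by
  linarith [orbitForm_swap z ζ ζ]

theorem coadVec_mem {ζ z : Triple} (hz : z ∈ lieAlg) : coadVec ζ z ∈ lieAlg :=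
  mem_lieAlg.2 (infAct_mem (mem_lieAlg.1 hz) _)

/-- The pairing as a map from the Lie algebra to its dual. -/
noncomputable def pairingHom : lieAlg →ₗ[ℝ] Module.Dual ℝ lieAlg :=
  LinearMap.mk₂ ℝ (fun ζ z => pairing z.1 ζ.1)
    (fun a b c => by simp [pairing, matPair_add_right]; ring)
    (fun a b c => by simp [pairing, matPair_smul_right]; ring)
    (fun a b c => by simp [pairing, matPair_add_left]; ring)
    (fun a b c => by simp [pairing, matPair_smul_left]; ring)

/-- The pairing restricted to `lieAlg` is positive definite, hence injective into the dual, and the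
dimensions agree. -/
theorem exists_pairing_eq (L : Triple →ₗ[ℝ] ℝ) :
    ∃ ζ ∈ lieAlg, ∀ z ∈ lieAlg, pairing z ζ = L z := by
  have hinj : Function.Injective pairingHom := by
    rw [injective_iff_map_eq_zero]
    rintro ⟨ζ, hζ⟩ h
    have h1 : pairing ζ ζ = 0 := by simpa [pairingHom] using LinearMap.congr_fun h ⟨ζ, hζ⟩
    have h2 : 0 ≤ ζ.2.1 ⬝ᵥ ζ.2.1 := by
      simp only [dotProduct]; exact Finset.sum_nonneg fun i _ => mul_self_nonneg _
    have h3 := matPair_self_nonneg ζ.2.2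
    have h4 := mul_self_nonneg ζ.1
    simp only [pairing] at h1
    have e1 : ζ.1 = 0 := mul_self_eq_zero.1 (by linarith)
    have e2 : ζ.2.1 = 0 := dotProduct_self_eq_zero.1 (by linarith)
    have e3 : ζ.2.2 = 0 := matPair_self_eq_zero (by linarith)
    exact Subtype.ext (Prod.ext e1 (Prod.ext e2 e3))
  have hsurj := (LinearMap.injective_iff_surjective_of_finrank_eq_finrank
    (Subspace.dual_finrank_eq (K := ℝ) (V := lieAlg)).symm).1 hinj
  obtain ⟨ζ, hζ⟩ := hsurj (L ∘ₗ lieAlg.subtype)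
  exact ⟨ζ.1, ζ.2, fun z hz => LinearMap.congr_fun hζ ⟨z, hz⟩⟩

/-- Every function has a Hamiltonian vector at every point. -/
theorem exists_isHamiltonianAt (O : Set Triple) (f : Triple → ℝ) {z : Triple} (hz : z ∈ lieAlg) :
    ∃ ζ, IsHamiltonianAt O f z ζ := by
  -- Since ω(ζ, η) = -⟨coadVec η z, ζ⟩, any ζ representing minus the derivative is a Hamiltonian
  -- generator. Nondegeneracy of the orbit form is not needed.
  obtain ⟨ζ, hζ, h⟩ := exists_pairing_eq (-(fderivWithin ℝ f O z).toLinearMap)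
  refine ⟨ζ, hζ, fun η _ => ?_⟩
  rw [orbitForm_swap, orbitForm_eq_pairing, h _ (coadVec_mem hz)]
  simp [orbitDiff]

/-- A function that agrees to first order with the linear function ⟨·, ζ⟩ has the generator -ζ, the
sign coming from the minus orbit form. -/
theorem isHamiltonianAt_neg_of_pairing {O : Set Triple} {f : Triple → ℝ} {z ζ : Triple}
    (hζ : ζ ∈ lieAlg) (h : ∀ η ∈ lieAlg, orbitDiff O f z η = pairing (coadVec η z) ζ) :
    IsHamiltonianAt O f z (-ζ) := by
  refine ⟨neg_mem hζ, fun η hη => ?_⟩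
  rw [h η hη, ← orbitForm_eq_pairing, orbitForm_swap, orbitForm_eq_pairing,
    orbitForm_eq_pairing]
  simp [pairing, matPair]
  ring

theorem IsPoissonBracketAt.swap {O : Set Triple} {f g : Triple → ℝ} {z : Triple}
    (h : IsPoissonBracketAt O f g z 0) : IsPoissonBracketAt O g f z 0 := by
  obtain ⟨ζ, η, h1, h2, h3⟩ := h
  exact ⟨η, ζ, h2, h1, by rw [orbitForm_swap, h3, neg_zero]⟩

theorem isPoissonBracketAt_self {O : Set Triple} (f : Triple → ℝ) {z : Triple}
    (hz : z ∈ lieAlg) : IsPoissonBracketAt O f f z 0 := by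
  obtain ⟨ζ, h⟩ := exists_isHamiltonianAt O f hz
  exact ⟨ζ, ζ, h, h, orbitForm_self z ζ⟩

/-- The bracket is the derivative of f along the Hamiltonian vector of g. A generator for f only has
to exist, so h never needs an explicit Hamiltonian vector. -/
theorem isPoissonBracketAt_zero {O : Set Triple} {f g : Triple → ℝ} {z η : Triple}
    (hz : z ∈ lieAlg) (hη : IsHamiltonianAt O g z η) (h : orbitDiff O f z η = 0) :
    IsPoissonBracketAt O f g z 0 := by
  obtain ⟨ζ, hζ⟩ := exists_isHamiltonianAt O f hz
  exact ⟨ζ, η, hζ, hη, by rw [hζ.2 η hη.1, h]⟩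

/-! ### Uniaxial matrices and the description of the coadjoint orbit -/

/-- The matrix `u (1 - 3 n nᵀ)`. -/
noncomputable def uniaxial (u : Circle) (n : Fin 3 → ℝ) : Mat3 :=
  (u : ℂ) • toComplex (1 - (3 : ℝ) • Matrix.vecMulVec n n)

theorem toComplex_mul (A B : Matrix (Fin 3) (Fin 3) ℝ) :
    toComplex (A * B) = toComplex A * toComplex B :=
  Matrix.map_mul (f := Complex.ofRealHom)

theorem toComplex_sub (A B : Matrix (Fin 3) (Fin 3) ℝ) :
    toComplex (A - B) = toComplex A - toComplex B := by
  ext i j; simp [toComplex]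

theorem toComplex_conjTranspose_mul (A B : Matrix (Fin 3) (Fin 3) ℝ) :
    (toComplex A)ᴴ * toComplex B = toComplex (Aᵀ * B) := by
  rw [toComplex_mul]
  congr 1
  ext i j
  simp [toComplex]

theorem trace_toComplex (A : Matrix (Fin 3) (Fin 3) ℝ) :
    (toComplex A).trace = (A.trace : ℂ) := by
  simp [Matrix.trace, toComplex]

theorem circle_conj_mul_self (u : Circle) : (starRingEnd ℂ) (u : ℂ) * u = 1 := by
  rw [← Circle.coe_inv_eq_conj, ← Circle.coe_mul, inv_mul_cancel, Circle.coe_one]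

/-- The common phase cancels. In particular real and imaginary coefficients are orthogonal, which
decouples phase motion from rotation. -/
theorem matPair_smul_toComplex (u : Circle) (α β : ℂ) (A B : Matrix (Fin 3) (Fin 3) ℝ) :
    matPair ((α * u) • toComplex A) ((β * u) • toComplex B) =
      ((starRingEnd ℂ) α * β).re * (Aᵀ * B).trace := by
  have h : star (α * u) * (β * u) = (starRingEnd ℂ) α * β := by
    rw [star_mul', Complex.star_def]
    linear_combination ((starRingEnd ℂ) α * β) * circle_conj_mul_self u
  rw [matPair, Matrix.conjTranspose_smul, Matrix.smul_mul, Matrix.mul_smul, smul_smul, h,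
    toComplex_conjTranspose_mul, Matrix.trace_smul, trace_toComplex, smul_eq_mul,
    Complex.re_mul_ofReal]

theorem groupAct_baseMat (u : Circle) (R : Matrix.specialOrthogonalGroup (Fin 3) ℝ) :
    groupAct u R baseMat = uniaxial u (R.1 *ᵥ basisVec 2) := by
  have hR : R.1 * R.1ᵀ = 1 := (Matrix.mem_orthogonalGroup_iff (Fin 3) ℝ).1 R.2.1
  have hb : baseMat = toComplex (1 - (3 : ℝ) • Matrix.vecMulVec (basisVec 2) (basisVec 2)) := by
    ext i j
    fin_cases i <;> fin_cases j <;>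
      simp [baseMat, toComplex, basisVec, Matrix.vecMulVec_apply]
    norm_num
  rw [groupAct, uniaxial, hb, ← toComplex_mul, ← toComplex_mul, Matrix.mul_sub, Matrix.sub_mul,
    Matrix.mul_one, hR, Matrix.mul_smul, Matrix.smul_mul, Matrix.mul_vecMulVec,
    Matrix.vecMulVec_mul, Matrix.vecMul_transpose]

theorem uniaxial_mem {n : Fin 3 → ℝ} (hn : n ⬝ᵥ n = 1) (u : Circle) :
    uniaxial u n ∈ symTraceless := by
  refine ⟨?_, ?_⟩
  · ext i j
    simp [uniaxial, toComplex, Matrix.vecMulVec_apply, Matrix.one_apply, eq_comm, mul_comm]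
  · have h : ((1 - (3 : ℝ) • Matrix.vecMulVec n n).trace : ℝ) = 0 := by
      rw [Matrix.trace_sub, Matrix.trace_smul, Matrix.trace_vecMulVec, hn]
      simp
    have h2 : (toComplex (1 - (3 : ℝ) • Matrix.vecMulVec n n)).trace = 0 := by
      rw [trace_toComplex, h, Complex.ofReal_zero]
    rw [uniaxial, Matrix.trace_smul, h2, smul_zero]

/-- The symmetrized product `q nᵀ + n qᵀ`. -/
def symProd (q n : Fin 3 → ℝ) : Matrix (Fin 3) (Fin 3) ℝ :=
  Matrix.vecMulVec q n + Matrix.vecMulVec n q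

theorem symProd_apply (q n : Fin 3 → ℝ) (i j : Fin 3) :
    symProd q n i j = q i * n j + n i * q j := by
  simp [symProd, Matrix.vecMulVec_apply]

theorem cross_apply_zero (v w : Fin 3 → ℝ) : crossProduct v w 0 = v 1 * w 2 - v 2 * w 1 := by
  simp [cross_apply]

theorem cross_apply_one (v w : Fin 3 → ℝ) : crossProduct v w 1 = v 2 * w 0 - v 0 * w 2 := by
  simp [cross_apply]

theorem cross_apply_two (v w : Fin 3 → ℝ) : crossProduct v w 2 = v 0 * w 1 - v 1 * w 0 := by
  simp [cross_apply]

theorem symProd_mem {q n : Fin 3 → ℝ} (h : q ⬝ᵥ n = 0) (u : Circle) :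
    (u : ℂ) • toComplex (symProd q n) ∈ symTraceless := by
  refine ⟨?_, ?_⟩
  · ext i j
    simp [symProd, toComplex, Matrix.vecMulVec_apply]
    ring
  · have h1 : (symProd q n).trace = 0 := by
      rw [symProd, Matrix.trace_add, Matrix.trace_vecMulVec, Matrix.trace_vecMulVec,
        dotProduct_comm n q, h, add_zero]
    have h2 : (toComplex (symProd q n)).trace = 0 := by
      rw [trace_toComplex, h1, Complex.ofReal_zero]
    rw [Matrix.trace_smul, h2, smul_zero]

/-! ### Infinitesimal generators at a uniaxial matrix: inner products and isotropy -/

theorem infAct_smul_toComplex (ξ : ℝ × (Fin 3 → ℝ)) (u : Circle)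
    (A : Matrix (Fin 3) (Fin 3) ℝ) :
    infAct ξ ((u : ℂ) • toComplex A) = (Complex.I * ξ.1 * u) • toComplex A +
      (u : ℂ) • toComplex (hat ξ.2 * A - A * hat ξ.2) := by
  rw [toComplex_sub, toComplex_mul, toComplex_mul, infAct, smul_smul, smul_sub, Matrix.mul_smul,
    Matrix.smul_mul]

theorem hat_commutator_uniaxial (w n : Fin 3 → ℝ) :
    hat w * (1 - (3 : ℝ) • Matrix.vecMulVec n n) - (1 - (3 : ℝ) • Matrix.vecMulVec n n) * hat w =
      (-3 : ℝ) • symProd (crossProduct w n) n := by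
  rw [Matrix.mul_sub, Matrix.sub_mul, Matrix.mul_one, Matrix.one_mul]
  ext i j
  simp only [Matrix.sub_apply, Matrix.mul_apply, Fin.sum_univ_three, Matrix.smul_apply,
    symProd_apply, Matrix.vecMulVec_apply, smul_eq_mul]
  fin_cases i <;> fin_cases j <;>
    simp [hat, cross_apply_zero, cross_apply_one, cross_apply_two] <;> ring

theorem infAct_uniaxial (ξ : ℝ × (Fin 3 → ℝ)) (u : Circle) (n : Fin 3 → ℝ) :
    infAct ξ (uniaxial u n) =
      (Complex.I * ξ.1 * u) • toComplex (1 - (3 : ℝ) • Matrix.vecMulVec n n) +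
      (u : ℂ) • toComplex ((-3 : ℝ) • symProd (crossProduct ξ.2 n) n) := by
  rw [uniaxial, infAct_smul_toComplex, hat_commutator_uniaxial]

theorem trace_uniaxial_sq {n : Fin 3 → ℝ} (hn : n ⬝ᵥ n = 1) :
    ((1 - (3 : ℝ) • Matrix.vecMulVec n n)ᵀ * (1 - (3 : ℝ) • Matrix.vecMulVec n n)).trace = 6 := by
  simp only [dotProduct, Fin.sum_univ_three] at hn
  simp [Matrix.trace, Matrix.mul_apply, Fin.sum_univ_three, Matrix.vecMulVec_apply]
  linear_combination (9 * (n 0 * n 0 + n 1 * n 1 + n 2 * n 2) + 3) * hn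

theorem trace_symProd_mul {n q q' : Fin 3 → ℝ} (hn : n ⬝ᵥ n = 1)
    (hq : q ⬝ᵥ n = 0) : ((symProd q n)ᵀ * symProd q' n).trace = 2 * (q ⬝ᵥ q') := by
  simp only [dotProduct, Fin.sum_univ_three] at hn hq
  simp [Matrix.trace, Matrix.mul_apply, Fin.sum_univ_three, symProd_apply, dotProduct]
  linear_combination 2 * (q 0 * q' 0 + q 1 * q' 1 + q 2 * q' 2) * hn +
    2 * (q' 0 * n 0 + q' 1 * n 1 + q' 2 * n 2) * hq

theorem cross_dotProduct_self (w n : Fin 3 → ℝ) : crossProduct w n ⬝ᵥ n = 0 := by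
  rw [dotProduct_comm, dot_cross_self]

theorem matPair_infAct_uniaxial_symProd {n q : Fin 3 → ℝ} (hn : n ⬝ᵥ n = 1) (u : Circle)
    (ξ : ℝ × (Fin 3 → ℝ)) :
    matPair (infAct ξ (uniaxial u n)) ((u : ℂ) • toComplex (symProd q n)) =
      -6 * (crossProduct ξ.2 n ⬝ᵥ q) := by
  have h2 := matPair_smul_toComplex u (Complex.I * ξ.1) 1 (1 - (3 : ℝ) • Matrix.vecMulVec n n)
    (symProd q n)
  have h3 := matPair_smul_toComplex u 1 1 ((-3 : ℝ) • symProd (crossProduct ξ.2 n) n)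
    (symProd q n)
  have h4 := trace_symProd_mul (q' := q) hn (cross_dotProduct_self ξ.2 n)
  rw [infAct_uniaxial, matPair_add_left]
  rw [one_mul] at h2 h3
  rw [h2, h3, Matrix.transpose_smul, Matrix.smul_mul, Matrix.trace_smul, h4]
  simp
  ring

theorem matPair_infAct_uniaxial {n : Fin 3 → ℝ} (hn : n ⬝ᵥ n = 1) (u : Circle)
    (ξ η : ℝ × (Fin 3 → ℝ)) :
    matPair (infAct ξ (uniaxial u n)) (infAct η (uniaxial u n)) =
      6 * (ξ.1 * η.1) + 18 * (crossProduct ξ.2 n ⬝ᵥ crossProduct η.2 n) := by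
  have h1 := matPair_smul_toComplex u (Complex.I * ξ.1) (Complex.I * η.1)
    (1 - (3 : ℝ) • Matrix.vecMulVec n n) (1 - (3 : ℝ) • Matrix.vecMulVec n n)
  have h2 := matPair_smul_toComplex u 1 (Complex.I * η.1)
    ((-3 : ℝ) • symProd (crossProduct ξ.2 n) n) (1 - (3 : ℝ) • Matrix.vecMulVec n n)
  have h3 := matPair_infAct_uniaxial_symProd (q := crossProduct ((-3 : ℝ) • η.2) n) hn u ξ
  have h4 : (-3 : ℝ) • symProd (crossProduct η.2 n) n = symProd (crossProduct ((-3 : ℝ) • η.2) n) n := by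
    ext i j
    simp [symProd_apply]
    ring
  rw [infAct_uniaxial η, h4, matPair_add_right, h3, infAct_uniaxial, matPair_add_left]
  rw [one_mul] at h2
  rw [h1, h2, trace_uniaxial_sq hn]
  simp
  ring

theorem infAct_uniaxial_self (u : Circle) (n : Fin 3 → ℝ) :
    infAct (0, n) (uniaxial u n) = 0 := by
  rw [infAct_uniaxial]
  simp only [cross_self, symProd]
  ext i j
  simp [toComplex]

/-- After division by u, the imaginary part is v(1 - 3nnᵀ) and the real part is a multiple of the
symmetrized product of w × n with n, so both vanish. -/
theorem infAct_uniaxial_eq_zero {ξ : ℝ × (Fin 3 → ℝ)} {u : Circle} {n : Fin 3 → ℝ}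
    (hn : n ⬝ᵥ n = 1) (h : infAct ξ (uniaxial u n) = 0) :
    ξ.1 = 0 ∧ crossProduct ξ.2 n = 0 := by
  have hu : (u : ℂ) ≠ 0 := u.coe_ne_zero
  have h1 : ∀ i j, ξ.1 * (1 - (3 : ℝ) • Matrix.vecMulVec n n) i j = 0 ∧
      symProd (crossProduct ξ.2 n) n i j = 0 := by
    intro i j
    have h2 := congrFun (congrFun h i) j
    rw [infAct_uniaxial, mul_comm, mul_smul, ← smul_add] at h2
    have h3 : (Complex.I * ξ.1) * ((1 - (3 : ℝ) • Matrix.vecMulVec n n) i j : ℝ) +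
      (((-3 : ℝ) • symProd (crossProduct ξ.2 n) n) i j : ℝ) = 0 := by
      simpa only [Matrix.smul_apply, Matrix.zero_apply, Matrix.add_apply, toComplex,
        Matrix.map_apply, smul_eq_mul, mul_eq_zero, hu, false_or] using h2
    have hr := congrArg Complex.re h3
    have hi := congrArg Complex.im h3
    simp [-Matrix.sub_apply, -Matrix.smul_apply, -Complex.ofReal_mul] at hr hi
    refine ⟨?_, ?_⟩
    · simpa using hi
    · simpa using hr
  have hn' : n 0 * n 0 + n 1 * n 1 + n 2 * n 2 = 1 := by
    simpa [dotProduct, Fin.sum_univ_three] using hn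
  constructor
  · have a := (h1 0 0).1
    have b := (h1 1 1).1
    have c := (h1 0 1).1
    have d := (h1 2 2).1
    have e := (h1 0 2).1
    have f := (h1 1 2).1
    simp [Matrix.vecMulVec_apply] at a b c d e f
    -- Otherwise 1 = 3nnᵀ, and n₁² = n₂² = 1/3 contradicts n₁n₂ = 0.
    by_contra hv
    have a' : 1 - 3 * (n 0 * n 0) = 0 := by tauto
    have b' : 1 - 3 * (n 1 * n 1) = 0 := by tauto
    have c' : n 0 * n 1 = 0 := by rw [mul_eq_zero]; tauto
    nlinarith
  · have key : ∀ x : Fin 3 → ℝ, x ⬝ᵥ n = 0 → (∀ i j, symProd x n i j = 0) → x = 0 := by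
      intro x hx hs
      have : symProd x n *ᵥ n = x := by
        rw [symProd, Matrix.add_mulVec, Matrix.vecMulVec_mulVec, Matrix.vecMulVec_mulVec, hn, hx]
        simp
      rw [← this]
      ext i
      simp [Matrix.mulVec, dotProduct, hs]
    refine key _ ?_ fun i j => (h1 i j).2
    rw [dotProduct_comm, dot_cross_self]

/-- The isotropy element (0, n) kills the matrix, so by skew-adjointness a translation cannot change
the momentum component along n. This makes m'·n an invariant of the orbit. -/
theorem diamond_dotProduct_eq_zero (U : Mat3) (u : Circle) (n : Fin 3 → ℝ) :
    (diamond U (uniaxial u n)).2 ⬝ᵥ n = 0 := by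
  have := diamond_pair U (uniaxial u n) (0, n)
  rw [matPair_infAct, infAct_uniaxial_self] at this
  simpa [matPair] using this

/-- The diamond operation reaches every covector that annihilates the isotropy algebra. -/
theorem exists_diamond_eq {n : Fin 3 → ℝ} (hn : n ⬝ᵥ n = 1) (u : Circle) (x : ℝ)
    {y : Fin 3 → ℝ} (hy : y ⬝ᵥ n = 0) :
    ∃ U ∈ symTraceless, diamond U (uniaxial u n) = (x, y) := by
  obtain ⟨q, hq, hqn⟩ : ∃ q : Fin 3 → ℝ, q ⬝ᵥ n = 0 ∧ y = (6 : ℝ) • crossProduct n q := by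
    refine ⟨(1 / 6 : ℝ) • crossProduct y n, ?_, ?_⟩
    · rw [smul_dotProduct, dotProduct_comm, dot_cross_self, smul_zero]
    · rw [map_smul, smul_smul]
      simp only [dotProduct, Fin.sum_univ_three] at hn hy
      ext i
      fin_cases i <;> simp [cross_apply]
      · linear_combination (-y 0) * hn + (n 0) * hy
      · linear_combination (-y 1) * hn + (n 1) * hy
      · linear_combination (-y 2) * hn + (n 2) * hy
  have hS := uniaxial_mem hn u
  -- By skew-adjointness the covector is -⟨ξA, U⟩. The factor 1/6 comes from |iA|² = 6, and q was
  -- scaled to absorb the 6 in `matPair_infAct_uniaxial_symProd`.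
  refine ⟨(-x / 6) • infAct (1, 0) (uniaxial u n) + (u : ℂ) • toComplex (symProd q n),
    add_mem (symTraceless.smul_mem _ (infAct_mem hS _)) (symProd_mem hq u), ?_⟩
  have h1 : ∀ ξ : ℝ × (Fin 3 → ℝ), matPair (uniaxial u n) (infAct ξ ((-x / 6) •
      infAct (1, 0) (uniaxial u n) + (u : ℂ) • toComplex (symProd q n))) =
      x * ξ.1 + y ⬝ᵥ ξ.2 := by
    intro ξ
    have e : crossProduct ξ.2 n ⬝ᵥ q * 6 = y ⬝ᵥ ξ.2 := by
      rw [hqn, smul_dotProduct, dotProduct_comm, triple_product_permutation, smul_eq_mul,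
        mul_comm, dotProduct_comm]
    rw [matPair_infAct, matPair_add_right, matPair_smul_right, matPair_infAct_uniaxial hn,
      matPair_infAct_uniaxial_symProd hn _ _, ← e]
    simp
    ring
  ext a
  · simpa [diamond] using h1 (1, 0)
  · simpa [diamond, basisVec] using h1 (0, basisVec a)

theorem exists_rotation {n : Fin 3 → ℝ} (hn : n ⬝ᵥ n = 1) :
    ∃ R : Matrix.specialOrthogonalGroup (Fin 3) ℝ, R.1 *ᵥ basisVec 2 = n := by
  have hn' : n 0 * n 0 + n 1 * n 1 + n 2 * n 2 = 1 := by
    simpa [dotProduct, Fin.sum_univ_three] using hn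
  by_cases h : 1 + n 2 = 0
  · have h2 : n 2 = -1 := by linarith
    have h0 : n 0 = 0 := by rw [h2] at hn'; nlinarith [sq_nonneg (n 0), sq_nonneg (n 1)]
    have h1 : n 1 = 0 := by rw [h2] at hn'; nlinarith [sq_nonneg (n 0), sq_nonneg (n 1)]
    -- For n = -e₃ a half-turn about the first axis is used.
    refine ⟨⟨Matrix.diagonal ![1, -1, -1], ?_⟩, ?_⟩
    · rw [Matrix.mem_specialOrthogonalGroup_iff, Matrix.mem_orthogonalGroup_iff]
      constructor
      · ext i j
        fin_cases i <;> fin_cases j <;> simp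
      · simp [Fin.prod_univ_three]
    · ext i
      fin_cases i <;> simp [basisVec, Matrix.mulVec_diagonal, h0, h1, h2]
  · set w : Fin 3 → ℝ := n + basisVec 2 with hw
    have w0 : w 0 = n 0 := by simp [w, basisVec]
    have w1 : w 1 = n 1 := by simp [w, basisVec]
    have w2 : w 2 = n 2 + 1 := by simp [w, basisVec]
    obtain ⟨t, ht⟩ : ∃ t : ℝ, t * (1 + n 2) = 1 := ⟨(1 + n 2)⁻¹, inv_mul_cancel₀ h⟩
    -- The half-turn about the bisector w = n + e₃ swaps e₃ and n; here t = 2/|w|².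
    refine ⟨⟨t • Matrix.vecMulVec w w - 1, ?_⟩, ?_⟩
    · rw [Matrix.mem_specialOrthogonalGroup_iff, Matrix.mem_orthogonalGroup_iff]
      have hww : w ⬝ᵥ w = 2 * (1 + n 2) := by
        simp only [dotProduct, Fin.sum_univ_three, w0, w1, w2]
        linear_combination hn'
      constructor
      · have : (t • Matrix.vecMulVec w w - 1)ᵀ = t • Matrix.vecMulVec w w - 1 := by
          ext i j
          simp [Matrix.vecMulVec_apply, Matrix.one_apply, eq_comm, mul_comm]
        rw [this, Matrix.mul_sub, Matrix.sub_mul, Matrix.smul_mul, Matrix.mul_smul,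
          Matrix.vecMulVec_mul_vecMulVec, hww]
        ext i j
        simp [Matrix.vecMulVec_apply]
        linear_combination (2 * t * w i * w j) * ht
      · rw [Matrix.det_fin_three]
        simp [Matrix.vecMulVec_apply]
        have : t * (w 0 * w 0 + w 1 * w 1 + w 2 * w 2) = 2 := by
          rw [w0, w1, w2]
          linear_combination t * hn' + 2 * ht
        linear_combination this
    · have hwe : w ⬝ᵥ basisVec 2 = 1 + n 2 := by simp [basisVec, w2, add_comm]
      simp only [Matrix.sub_mulVec, Matrix.smul_mulVec, Matrix.vecMulVec_mulVec, hwe,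
        Matrix.one_mulVec]
      ext i
      simp [hw]
      linear_combination (n i + basisVec 2 i) * ht

/-- The coadjoint orbits of the `Ω₁`-phase are given by the unit vectors `n`, the phases `u` and
the momenta with prescribed component along `n`. -/
theorem mem_coadOrbit_iff {p : ℝ} {m : Fin 3 → ℝ} {z : Triple} :
    z ∈ coadOrbit (p, m, baseMat) ↔ ∃ (u : Circle) (n : Fin 3 → ℝ), n ⬝ᵥ n = 1 ∧
      z.2.1 ⬝ᵥ n = m 2 ∧ z.2.2 = uniaxial u n := by
  have hR : ∀ (R : Matrix.specialOrthogonalGroup (Fin 3) ℝ) (x y : Fin 3 → ℝ),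
      (R.1 *ᵥ x) ⬝ᵥ (R.1 *ᵥ y) = x ⬝ᵥ y := by
    intro R x y
    have : R.1ᵀ * R.1 = 1 := (Matrix.mem_orthogonalGroup_iff' (Fin 3) ℝ).1 R.2.1
    rw [Matrix.dotProduct_mulVec, ← Matrix.mulVec_transpose, Matrix.mulVec_mulVec, this,
      Matrix.one_mulVec]
  constructor
  · rintro ⟨u, R, U, hU, rfl⟩
    refine ⟨u, R.1 *ᵥ basisVec 2, ?_, ?_, groupAct_baseMat u R⟩
    · rw [hR]; simp [basisVec]
    · simp only [coadAct, groupAct_baseMat, add_dotProduct, diamond_dotProduct_eq_zero, hR]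
      simp [basisVec]
  · rintro ⟨u, n, hn, hm, hA⟩
    obtain ⟨R, rfl⟩ := exists_rotation hn
    have hy : (z.2.1 - R.1 *ᵥ m) ⬝ᵥ (R.1 *ᵥ basisVec 2) = 0 := by
      rw [sub_dotProduct, hm, hR]; simp [basisVec]
    obtain ⟨U, hU, h⟩ := exists_diamond_eq hn u (z.1 - p) hy
    refine ⟨u, R, U, hU, ?_⟩
    simp only [coadAct, groupAct_baseMat, h]
    ext <;> simp [hA]

/-! ### The Legendre transformation -/

theorem gammaPair_add_left (γ : Fin 3 → ℝ) (A B C : Mat3) :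
    gammaPair γ (A + B) C = gammaPair γ A C + gammaPair γ B C := by
  simp [gammaPair, Matrix.mul_add, Matrix.add_mul]

theorem gammaPair_add_right (γ : Fin 3 → ℝ) (A B C : Mat3) :
    gammaPair γ A (B + C) = gammaPair γ A B + gammaPair γ A C := by
  simp [gammaPair, Matrix.mul_add]

theorem gammaPair_smul_left (γ : Fin 3 → ℝ) (c : ℝ) (A B : Mat3) :
    gammaPair γ (c • A) B = c * gammaPair γ A B := by
  simp [gammaPair]

theorem gammaPair_smul_right (γ : Fin 3 → ℝ) (c : ℝ) (A B : Mat3) :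
    gammaPair γ A (c • B) = c * gammaPair γ A B := by
  simp [gammaPair]

theorem gammaPair_smul_toComplex (γ : Fin 3 → ℝ) (u : Circle) (α β : ℂ)
    (A B : Matrix (Fin 3) (Fin 3) ℝ) :
    gammaPair γ ((α * u) • toComplex A) ((β * u) • toComplex B) =
      ((starRingEnd ℂ) α * β).re *
        (Matrix.diagonal ![γ 0, γ 0, γ 0 + γ 1 + γ 2] * (Aᵀ * B)).trace := by
  have h : star (α * u) * (β * u) = (starRingEnd ℂ) α * β := by
    rw [star_mul', Complex.star_def]
    linear_combination ((starRingEnd ℂ) α * β) * circle_conj_mul_self u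
  rw [gammaPair, Matrix.conjTranspose_smul, Matrix.mul_smul, Matrix.mul_smul, Matrix.smul_mul,
    smul_smul, mul_comm, h, Matrix.mul_assoc, toComplex_conjTranspose_mul, ← toComplex_mul,
    Matrix.trace_smul, trace_toComplex, smul_eq_mul, Complex.re_mul_ofReal]

theorem cross_smul_left (c : ℝ) (w n : Fin 3 → ℝ) :
    crossProduct (c • w) n = c • crossProduct w n := by
  rw [map_smul, LinearMap.smul_apply]

theorem trace_gamma_uniaxial_sq (g d : ℝ) {n : Fin 3 → ℝ} (hn : n ⬝ᵥ n = 1) :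
    (Matrix.diagonal ![g, g, g + d] * ((1 - (3 : ℝ) • Matrix.vecMulVec n n)ᵀ *
      (1 - (3 : ℝ) • Matrix.vecMulVec n n))).trace = 6 * g + d * (1 + 3 * n 2 ^ 2) := by
  simp only [dotProduct, Fin.sum_univ_three] at hn
  simp [Matrix.trace, Matrix.mul_apply, Fin.sum_univ_three, Matrix.vecMulVec_apply,
    Matrix.diagonal_apply]
  linear_combination (g * (9 * (n 0 * n 0 + n 1 * n 1 + n 2 * n 2) + 3) + 9 * d * n 2 ^ 2) * hn

theorem trace_gamma_symProd_mul (g d : ℝ) {n q q' : Fin 3 → ℝ} (hn : n ⬝ᵥ n = 1)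
    (hq : q ⬝ᵥ n = 0) (hq' : q' ⬝ᵥ n = 0) :
    (Matrix.diagonal ![g, g, g + d] * ((symProd q n)ᵀ * symProd q' n)).trace =
      (2 * g + d * n 2 ^ 2) * (q ⬝ᵥ q') + d * (q 2 * q' 2) := by
  simp only [dotProduct, Fin.sum_univ_three] at hn hq hq'
  simp [Matrix.trace, Matrix.mul_apply, Fin.sum_univ_three, symProd_apply, dotProduct,
    Matrix.diagonal_apply]
  linear_combination (2 * g * (q 0 * q' 0 + q 1 * q' 1 + q 2 * q' 2) + d * q 2 * q' 2) * hn +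
    (2 * g * (q' 0 * n 0 + q' 1 * n 1 + q' 2 * n 2) + d * n 2 * q' 2) * hq + d * n 2 * q 2 * hq'

/-- The weight Γ is g plus d times the projection on e₃. The phase and rotation parts carry
imaginary and real coefficients, so no mixed terms occur. -/
theorem gammaPair_infAct_uniaxial (γ : Fin 3 → ℝ) {n : Fin 3 → ℝ} (hn : n ⬝ᵥ n = 1)
    (u : Circle) (ξ η : ℝ × (Fin 3 → ℝ)) :
    gammaPair γ (infAct ξ (uniaxial u n)) (infAct η (uniaxial u n)) =
      (6 * γ 0 + (γ 1 + γ 2) * (1 + 3 * n 2 ^ 2)) * (ξ.1 * η.1) +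
      9 * ((2 * γ 0 + (γ 1 + γ 2) * n 2 ^ 2) * (crossProduct ξ.2 n ⬝ᵥ crossProduct η.2 n) +
        (γ 1 + γ 2) * (crossProduct ξ.2 n 2 * crossProduct η.2 n 2)) := by
  have hs : ∀ w : Fin 3 → ℝ, (-3 : ℝ) • symProd (crossProduct w n) n =
      symProd (crossProduct ((-3 : ℝ) • w) n) n := by
    intro w
    ext i j
    simp [symProd_apply]
    ring
  have h1 := gammaPair_smul_toComplex γ u (Complex.I * ξ.1) (Complex.I * η.1)
    (1 - (3 : ℝ) • Matrix.vecMulVec n n) (1 - (3 : ℝ) • Matrix.vecMulVec n n)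
  have h2 := gammaPair_smul_toComplex γ u (Complex.I * ξ.1) 1
    (1 - (3 : ℝ) • Matrix.vecMulVec n n) (symProd (crossProduct ((-3 : ℝ) • η.2) n) n)
  have h3 := gammaPair_smul_toComplex γ u 1 (Complex.I * η.1)
    (symProd (crossProduct ((-3 : ℝ) • ξ.2) n) n) (1 - (3 : ℝ) • Matrix.vecMulVec n n)
  have h4 := gammaPair_smul_toComplex γ u 1 1
    (symProd (crossProduct ((-3 : ℝ) • ξ.2) n) n) (symProd (crossProduct ((-3 : ℝ) • η.2) n) n)
  rw [one_mul] at h2 h3 h4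
  rw [infAct_uniaxial, infAct_uniaxial, hs, hs, gammaPair_add_left, gammaPair_add_right,
    gammaPair_add_right, h1, h2, h3, h4, add_assoc (γ 0), trace_gamma_uniaxial_sq _ _ hn,
    trace_gamma_symProd_mul _ _ hn (cross_dotProduct_self _ n) (cross_dotProduct_self _ n),
    cross_smul_left, cross_smul_left]
  simp
  ring

theorem lagrangian_add_smul (γ : Fin 3 → ℝ) {n : Fin 3 → ℝ} (hn : n ⬝ᵥ n = 1) (u : Circle)
    (ξ η : ℝ × (Fin 3 → ℝ)) (t : ℝ) :
    lagrangian γ (ξ + t • η) (uniaxial u n) = lagrangian γ ξ (uniaxial u n) +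
      t * (2 * gammaPair γ (infAct ξ (uniaxial u n)) (infAct η (uniaxial u n))) +
      t ^ 2 * lagrangian γ η (uniaxial u n) := by
  have h : gammaPair γ (infAct η (uniaxial u n)) (infAct ξ (uniaxial u n)) =
      gammaPair γ (infAct ξ (uniaxial u n)) (infAct η (uniaxial u n)) := by
    rw [gammaPair_infAct_uniaxial γ hn, gammaPair_infAct_uniaxial γ hn, dotProduct_comm]
    ring
  simp only [lagrangian, infAct_add_left, infAct_smul_left, gammaPair_add_left,
    gammaPair_add_right, gammaPair_smul_left, gammaPair_smul_right, h]
  ring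

theorem hasDerivAt_lagrangian (γ : Fin 3 → ℝ) {n : Fin 3 → ℝ} (hn : n ⬝ᵥ n = 1) (u : Circle)
    (ξ η : ℝ × (Fin 3 → ℝ)) :
    HasDerivAt (fun t : ℝ => lagrangian γ (ξ + t • η) (uniaxial u n))
      (2 * gammaPair γ (infAct ξ (uniaxial u n)) (infAct η (uniaxial u n))) 0 := by
  simp only [lagrangian_add_smul γ hn]
  refine HasDerivAt.congr_deriv ((((hasDerivAt_id' (0 : ℝ)).mul_const
    (2 * gammaPair γ (infAct ξ (uniaxial u n)) (infAct η (uniaxial u n)))).const_add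
      (lagrangian γ ξ (uniaxial u n))).add
    (((hasDerivAt_id' (0 : ℝ)).pow 2).mul_const (lagrangian γ η (uniaxial u n)))) ?_
  simp

theorem isHorizontal_uniaxial {n : Fin 3 → ℝ} (hn : n ⬝ᵥ n = 1) (u : Circle)
    (ξ : ℝ × (Fin 3 → ℝ)) : IsHorizontal (uniaxial u n) ξ ↔ ξ.2 ⬝ᵥ n = 0 := by
  constructor
  · intro h
    have := h (0, n) (infAct_uniaxial_self u n)
    rw [dotProduct_comm]
    simpa using this
  · intro h κ hκ
    obtain ⟨h1, h2⟩ := infAct_uniaxial_eq_zero hn hκ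
    have h3 : κ.2 = (κ.2 ⬝ᵥ n) • n := by
      have := congrFun h2
      simp only [dotProduct, Fin.sum_univ_three] at hn ⊢
      have c0 := this 0
      have c1 := this 1
      have c2 := this 2
      simp only [cross_apply_zero, cross_apply_one, cross_apply_two, Pi.zero_apply] at c0 c1 c2
      ext i
      fin_cases i <;> simp
      · linear_combination (-κ.2 0) * hn + n 1 * c2 - n 2 * c1
      · linear_combination (-κ.2 1) * hn - n 0 * c2 + n 2 * c0
      · linear_combination (-κ.2 2) * hn + n 0 * c1 - n 1 * c0
    rw [h1, h3, smul_dotProduct, dotProduct_comm n, h]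
    simp

theorem isVelocity_iff {γ : Fin 3 → ℝ} {n : Fin 3 → ℝ} (hn : n ⬝ᵥ n = 1) {u : Circle}
    {z : Triple} (hz : z.2.2 = uniaxial u n) (ξ : ℝ × (Fin 3 → ℝ)) :
    IsVelocity γ z ξ ↔ ξ.2 ⬝ᵥ n = 0 ∧ ∀ η : ℝ × (Fin 3 → ℝ), η.2 ⬝ᵥ n = 0 →
      2 * gammaPair γ (infAct ξ (uniaxial u n)) (infAct η (uniaxial u n)) =
        z.1 * η.1 + z.2.1 ⬝ᵥ η.2 := by
  simp only [IsVelocity, hz, isHorizontal_uniaxial hn]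
  refine and_congr_right fun _ => forall₂_congr fun η _ => ?_
  exact ⟨fun h => (hasDerivAt_lagrangian γ hn u ξ η).unique h,
    fun h => h ▸ hasDerivAt_lagrangian γ hn u ξ η⟩

/-- The velocity `n × ν` is given by the tangent vector `ν` of the sphere. -/
noncomputable def sphereVelocity (g d : ℝ) (m n : Fin 3 → ℝ) : Fin 3 → ℝ :=
  (2 * g + d * n 2 ^ 2)⁻¹ • ((1 / 18 : ℝ) • crossProduct m n -
    (d * (crossProduct m n 2 / (18 * (2 * g + d)))) • (basisVec 2 - n 2 • n))

theorem sphereVelocity_dotProduct (g d : ℝ) (m : Fin 3 → ℝ) {n q : Fin 3 → ℝ}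
    (hq : q ⬝ᵥ n = 0) : sphereVelocity g d m n ⬝ᵥ q = (2 * g + d * n 2 ^ 2)⁻¹ *
      ((1 / 18) * (crossProduct m n ⬝ᵥ q) -
        d * (crossProduct m n 2 / (18 * (2 * g + d))) * q 2) := by
  have : basisVec 2 ⬝ᵥ q = q 2 := by simp [basisVec]
  rw [sphereVelocity, smul_dotProduct, sub_dotProduct, smul_dotProduct, smul_dotProduct,
    sub_dotProduct, smul_dotProduct, this, dotProduct_comm n, hq]
  simp

theorem sphereVelocity_dotProduct_self (g d : ℝ) (m : Fin 3 → ℝ) {n : Fin 3 → ℝ}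
    (hn : n ⬝ᵥ n = 1) : sphereVelocity g d m n ⬝ᵥ n = 0 := by
  have : basisVec 2 ⬝ᵥ n = n 2 := by simp [basisVec]
  rw [sphereVelocity, smul_dotProduct, sub_dotProduct, smul_dotProduct, smul_dotProduct,
    sub_dotProduct, smul_dotProduct, this, cross_dotProduct_self, hn]
  simp

/-- Confirms the value of ν₃ substituted in the definition: the third component of 18(bν + dν₃(e₃ -
n₃n)) = m × n is a scalar equation, as b + d(1 - n₃²) = 2g + d. -/
theorem sphereVelocity_two {g d : ℝ} (hg : 0 < g) (hd : 0 < d) (m n : Fin 3 → ℝ) :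
    sphereVelocity g d m n 2 = crossProduct m n 2 / (18 * (2 * g + d)) := by
  have h1 : 2 * g + d * n 2 ^ 2 ≠ 0 := by positivity
  have h2 : 2 * g + d ≠ 0 := by positivity
  simp [sphereVelocity, basisVec]
  field_simp
  ring

theorem cross_cross_self {n q : Fin 3 → ℝ} (hn : n ⬝ᵥ n = 1) (hq : q ⬝ᵥ n = 0) :
    crossProduct (crossProduct n q) n = q := by
  simp only [dotProduct, Fin.sum_univ_three] at hn hq
  ext i
  fin_cases i <;> simp [cross_apply]
  · linear_combination q 0 * hn - n 0 * hq
  · linear_combination q 1 * hn - n 1 * hq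
  · linear_combination q 2 * hn - n 2 * hq

theorem cross_cross_self' {n q : Fin 3 → ℝ} (hn : n ⬝ᵥ n = 1) (hq : q ⬝ᵥ n = 0) :
    crossProduct n (crossProduct q n) = q := by
  rw [← cross_anticomm, ← LinearMap.neg_apply, ← map_neg, cross_anticomm, cross_cross_self hn hq]

/-- The map x ↦ x × n is the projection to the plane orthogonal to n followed by a quarter turn.
Thus m acts on sphere velocities w × n through m × n. -/
theorem dotProduct_eq_cross_dotProduct_cross (m : Fin 3 → ℝ) {n w : Fin 3 → ℝ}
    (hn : n ⬝ᵥ n = 1) (hw : w ⬝ᵥ n = 0) :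
    m ⬝ᵥ w = crossProduct m n ⬝ᵥ crossProduct w n := by
  simp only [dotProduct, Fin.sum_univ_three] at hn hw
  simp [cross_apply, dotProduct, Fin.sum_univ_three]
  linear_combination (-(m 0 * w 0 + m 1 * w 1 + m 2 * w 2)) * hn +
    (m 0 * n 0 + m 1 * n 1 + m 2 * n 2) * hw

theorem isVelocity_explicit {γ : Fin 3 → ℝ} (hg : 0 < γ 0) (hd : 0 < γ 1 + γ 2)
    {n : Fin 3 → ℝ} (hn : n ⬝ᵥ n = 1) {u : Circle} {z : Triple} (hz : z.2.2 = uniaxial u n) :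
    IsVelocity γ z (z.1 / (2 * (6 * γ 0 + (γ 1 + γ 2) * (1 + 3 * n 2 ^ 2))),
      crossProduct n (sphereVelocity (γ 0) (γ 1 + γ 2) z.2.1 n)) := by
  rw [isVelocity_iff hn hz]
  refine ⟨?_, fun η hη => ?_⟩
  · rw [dotProduct_comm, dot_self_cross]
  · have h1 : 2 * γ 0 + (γ 1 + γ 2) * n 2 ^ 2 ≠ 0 := by positivity
    have h2 : 6 * γ 0 + (γ 1 + γ 2) * (1 + 3 * n 2 ^ 2) ≠ 0 := by positivity
    rw [gammaPair_infAct_uniaxial γ hn, cross_cross_self hn (sphereVelocity_dotProduct_self _ _ _ hn),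
      sphereVelocity_dotProduct _ _ _ (cross_dotProduct_self _ _), sphereVelocity_two hg hd,
      dotProduct_eq_cross_dotProduct_cross z.2.1 hn hη]
    field_simp
    ring

theorem existsUnique_isVelocity {γ : Fin 3 → ℝ} (hg : 0 < γ 0) (hd : 0 < γ 1 + γ 2)
    {n : Fin 3 → ℝ} (hn : n ⬝ᵥ n = 1) {u : Circle} {z : Triple} (hz : z.2.2 = uniaxial u n) :
    ∃! ξ, IsVelocity γ z ξ := by
  refine ⟨_, isVelocity_explicit hg hd hn hz, ?_⟩
  have key : ∀ ξ η, IsVelocity γ z ξ → IsVelocity γ z η → ξ = η := by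
    intro ξ η h1 h2
    rw [isVelocity_iff hn hz] at h1 h2
    have h3 : (ξ - η).2 ⬝ᵥ n = 0 := by
      rw [Prod.snd_sub, sub_dotProduct, h1.1, h2.1, sub_zero]
    -- Testing both velocity equations against their horizontal difference shows that its kinetic
    -- energy vanishes; all three squares in it have positive weights.
    have h4 : gammaPair γ (infAct (ξ - η) (uniaxial u n)) (infAct (ξ - η) (uniaxial u n)) = 0 := by
      have e1 := h1.2 _ h3
      have e2 := h2.2 _ h3
      have : infAct ξ (uniaxial u n) = infAct (ξ - η) (uniaxial u n) +
          infAct η (uniaxial u n) := by rw [← infAct_add_left, sub_add_cancel]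
      rw [this, gammaPair_add_left] at e1
      linarith
    rw [gammaPair_infAct_uniaxial γ hn] at h4
    set ν := crossProduct (ξ - η).2 n with hν
    have hνν : 0 ≤ ν ⬝ᵥ ν := by
      simp only [dotProduct]; exact Finset.sum_nonneg fun i _ => mul_self_nonneg _
    have ha : 0 < 6 * γ 0 + (γ 1 + γ 2) * (1 + 3 * n 2 ^ 2) := by positivity
    have hb : 0 < 2 * γ 0 + (γ 1 + γ 2) * n 2 ^ 2 := by positivity
    have t1 := mul_nonneg ha.le (mul_self_nonneg (ξ - η).1)
    have t2 := mul_nonneg hb.le hνν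
    have t3 := mul_nonneg hd.le (mul_self_nonneg (ν 2))
    have z1 : (ξ - η).1 = 0 := by
      have : (6 * γ 0 + (γ 1 + γ 2) * (1 + 3 * n 2 ^ 2)) * ((ξ - η).1 * (ξ - η).1) = 0 := by
        linarith
      simpa [ha.ne'] using this
    have z2 : ν = 0 := by
      have : (2 * γ 0 + (γ 1 + γ 2) * n 2 ^ 2) * (ν ⬝ᵥ ν) = 0 := by linarith
      rcases mul_eq_zero.1 this with h | h
      · exact absurd h hb.ne'
      · exact dotProduct_self_eq_zero.1 h
    have z3 : (ξ - η).2 = 0 := by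
      rw [← cross_cross_self' hn h3, ← hν, z2, map_zero]
    exact sub_eq_zero.1 (Prod.ext z1 z3)
  exact fun η hη => key _ _ hη (isVelocity_explicit hg hd hn hz)

theorem velocity_eq {γ : Fin 3 → ℝ} (hg : 0 < γ 0) (hd : 0 < γ 1 + γ 2)
    {n : Fin 3 → ℝ} (hn : n ⬝ᵥ n = 1) {u : Circle} {z : Triple} (hz : z.2.2 = uniaxial u n) :
    velocity γ z = (z.1 / (2 * (6 * γ 0 + (γ 1 + γ 2) * (1 + 3 * n 2 ^ 2))),
      crossProduct n (sphereVelocity (γ 0) (γ 1 + γ 2) z.2.1 n)) := by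
  have h := isVelocity_explicit hg hd hn hz
  rw [velocity, dif_pos ⟨_, h⟩]
  exact (existsUnique_isVelocity hg hd hn hz).unique
    (Exists.choose_spec (p := IsVelocity γ z) ⟨_, h⟩) h

/-- The vector iA is generated by the horizontal element (1, 0), so the Legendre relation in that
direction gives the momentum directly. -/
theorem circleMomentum_eq {γ : Fin 3 → ℝ} (hg : 0 < γ 0) (hd : 0 < γ 1 + γ 2)
    {n : Fin 3 → ℝ} (hn : n ⬝ᵥ n = 1) {u : Circle} {z : Triple} (hz : z.2.2 = uniaxial u n) :
    circleMomentum γ z = z.1 := by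
  have h := ((isVelocity_iff hn hz _).1 (isVelocity_explicit hg hd hn hz)).2 (1, 0) (by simp)
  have e : Complex.I • uniaxial u n = infAct (1, 0) (uniaxial u n) := by
    have : toComplex (hat 0) = 0 := by
      ext i j
      fin_cases i <;> fin_cases j <;> simp [toComplex, hat]
    simp [infAct, this]
  rw [circleMomentum, velocity_eq hg hd hn hz, hz, e, h]
  simp

/-- The Hamiltonian in terms of the momenta and the unit vector `n`. -/
noncomputable def reducedHamiltonian (g d c p : ℝ) (m n : Fin 3 → ℝ) : ℝ :=
  p ^ 2 / (4 * (6 * g + d * (1 + 3 * n 2 ^ 2))) +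
    (m ⬝ᵥ m - c ^ 2 - d / (2 * g + d) * (crossProduct m n 2) ^ 2) / (36 * (2 * g + d * n 2 ^ 2))

theorem hamiltonian_eq {γ : Fin 3 → ℝ} (hg : 0 < γ 0) (hd : 0 < γ 1 + γ 2)
    {n : Fin 3 → ℝ} (hn : n ⬝ᵥ n = 1) {u : Circle} {z : Triple} (hz : z.2.2 = uniaxial u n) :
    hamiltonian γ z = reducedHamiltonian (γ 0) (γ 1 + γ 2) (z.2.1 ⬝ᵥ n) z.1 z.2.1 n := by
  have hV := (isVelocity_iff hn hz _).1 (isVelocity_explicit hg hd hn hz)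
  -- The Legendre relation applied to the velocity itself says 2l = pv + m·w, so h is half of this
  -- pairing.
  have h := hV.2 _ hV.1
  have hm : crossProduct z.2.1 n ⬝ᵥ crossProduct z.2.1 n = z.2.1 ⬝ᵥ z.2.1 - (z.2.1 ⬝ᵥ n) ^ 2 := by
    simp only [dotProduct, Fin.sum_univ_three] at hn
    simp [cross_apply, dotProduct, Fin.sum_univ_three]
    linear_combination (z.2.1 0 * z.2.1 0 + z.2.1 1 * z.2.1 1 + z.2.1 2 * z.2.1 2) * hn
  have h1 : 2 * γ 0 + (γ 1 + γ 2) * n 2 ^ 2 ≠ 0 := by positivity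
  have h2 : 6 * γ 0 + (γ 1 + γ 2) * (1 + 3 * n 2 ^ 2) ≠ 0 := by positivity
  have h3 : 2 * γ 0 + (γ 1 + γ 2) ≠ 0 := by positivity
  have e : z.2.1 ⬝ᵥ crossProduct n (sphereVelocity (γ 0) (γ 1 + γ 2) z.2.1 n) =
      crossProduct z.2.1 n ⬝ᵥ sphereVelocity (γ 0) (γ 1 + γ 2) z.2.1 n := by
    rw [triple_product_permutation, triple_product_permutation, dotProduct_comm]
  rw [hamiltonian, velocity_eq hg hd hn hz, lagrangian, hz]
  rw [e] at h
  rw [dotProduct_comm (crossProduct z.2.1 n), sphereVelocity_dotProduct _ _ _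
    (cross_dotProduct_self _ n), hm] at h e
  simp only at h ⊢
  rw [e, reducedHamiltonian]
  have e1 : z.1 * (z.1 / (2 * (6 * γ 0 + (γ 1 + γ 2) * (1 + 3 * n 2 ^ 2)))) =
      2 * (z.1 ^ 2 / (4 * (6 * γ 0 + (γ 1 + γ 2) * (1 + 3 * n 2 ^ 2)))) := by
    field_simp
    ring
  have e2 : (2 * γ 0 + (γ 1 + γ 2) * n 2 ^ 2)⁻¹ * (1 / 18 * (z.2.1 ⬝ᵥ z.2.1 - (z.2.1 ⬝ᵥ n) ^ 2) -
      (γ 1 + γ 2) * (crossProduct z.2.1 n 2 / (18 * (2 * γ 0 + (γ 1 + γ 2)))) *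
        crossProduct z.2.1 n 2) =
      2 * ((z.2.1 ⬝ᵥ z.2.1 - (z.2.1 ⬝ᵥ n) ^ 2 - (γ 1 + γ 2) / (2 * γ 0 + (γ 1 + γ 2)) *
        (crossProduct z.2.1 n 2) ^ 2) / (36 * (2 * γ 0 + (γ 1 + γ 2) * n 2 ^ 2))) := by
    field_simp
    ring
  linarith

/-! ### Curves in the coadjoint orbits -/

/-- The rotation of `x` about the axis `w` given by the Cayley transform of `t ŵ / 2`. -/
noncomputable def cayley (w : Fin 3 → ℝ) (t : ℝ) (x : Fin 3 → ℝ) : Fin 3 → ℝ :=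
  x + (t / (1 + t ^ 2 * (w ⬝ᵥ w) / 4)) •
    (crossProduct w x + (t / 2) • crossProduct w (crossProduct w x))

theorem cayley_denom_pos (w : Fin 3 → ℝ) (t : ℝ) : 0 < 1 + t ^ 2 * (w ⬝ᵥ w) / 4 := by
  have : 0 ≤ w ⬝ᵥ w := by
    simp only [dotProduct]; exact Finset.sum_nonneg fun i _ => mul_self_nonneg _
  positivity

/-- The Cayley transform of a skew matrix is orthogonal. Naming the rational coefficient r leaves a
polynomial identity modulo its defining equation. -/
theorem cayley_dotProduct (w : Fin 3 → ℝ) (t : ℝ) (x y : Fin 3 → ℝ) :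
    cayley w t x ⬝ᵥ cayley w t y = x ⬝ᵥ y := by
  have h := (cayley_denom_pos w t).ne'
  obtain ⟨r, hr⟩ : ∃ r : ℝ, r * (1 + t ^ 2 * (w ⬝ᵥ w) / 4) = t := ⟨_, div_mul_cancel₀ t h⟩
  have hr' : t / (1 + t ^ 2 * (w ⬝ᵥ w) / 4) = r := by rw [div_eq_iff h, hr]
  simp only [cayley, hr']
  have hD : (t - r * (1 + t ^ 2 * (w ⬝ᵥ w) / 4)) *
      (crossProduct w x ⬝ᵥ crossProduct w y) = 0 := by rw [hr, sub_self, zero_mul]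
  simp only [dotProduct, Fin.sum_univ_three, Pi.add_apply, Pi.smul_apply, smul_eq_mul,
    cross_apply_zero, cross_apply_one, cross_apply_two] at hD ⊢
  linear_combination (-r) * hD

theorem cayley_zero (w x : Fin 3 → ℝ) : cayley w 0 x = x := by
  simp [cayley]

theorem cayley_zero_left (t : ℝ) (x : Fin 3 → ℝ) : cayley 0 t x = x := by
  simp [cayley]

theorem hasDerivAt_cayley (w x : Fin 3 → ℝ) :
    HasDerivAt (fun t => cayley w t x) (crossProduct w x) 0 := by
  have h1 : HasDerivAt (fun t : ℝ => t / (1 + t ^ 2 * (w ⬝ᵥ w) / 4)) 1 0 := by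
    refine ((hasDerivAt_id' (0 : ℝ)).div ((((hasDerivAt_id' (0 : ℝ)).pow 2).mul_const
      (w ⬝ᵥ w)).div_const 4 |>.const_add 1) (by simp)).congr_deriv ?_
    simp
  have h2 : HasDerivAt (fun t : ℝ => crossProduct w x +
      (t / 2) • crossProduct w (crossProduct w x))
      ((1 / 2 : ℝ) • crossProduct w (crossProduct w x)) 0 :=
    (((hasDerivAt_id' (0 : ℝ)).div_const 2).smul_const _).const_add _
  refine ((h1.smul h2).const_add x).congr_deriv ?_
  simp

theorem hasDerivAt_uniaxial (v : ℝ) (w : Fin 3 → ℝ) (u : Circle) (n : Fin 3 → ℝ) :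
    HasDerivAt (fun t : ℝ => uniaxial (Circle.exp (t * v) * u) (cayley w t n))
      (infAct (v, w) (uniaxial u n)) 0 := by
  have hn : ∀ i, HasDerivAt (fun t => cayley w t n i) (crossProduct w n i) 0 :=
    hasDerivAt_pi.1 (hasDerivAt_cayley w n)
  have hu : HasDerivAt (fun t : ℝ => ((Circle.exp (t * v) * u : Circle) : ℂ))
      (Complex.I * v * u) 0 := by
    have h1 : HasDerivAt (fun t : ℝ => ((t * v : ℝ) : ℂ) * Complex.I) ((v : ℂ) * Complex.I) 0 := by
      have : HasDerivAt (fun t : ℝ => t * v) v 0 := by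
        simpa using (hasDerivAt_id' (0 : ℝ)).mul_const v
      exact this.ofReal_comp.mul_const Complex.I
    have h2 := h1.cexp.mul_const (u : ℂ)
    simp only [Circle.coe_mul, Circle.coe_exp]
    refine h2.congr_deriv ?_
    simp
    ring
  rw [infAct_uniaxial]
  refine hasDerivAt_pi.2 fun i => hasDerivAt_pi.2 fun j => ?_
  have h := hu.mul (((((hn i).mul (hn j)).const_mul 3).const_sub
    ((1 : Matrix (Fin 3) (Fin 3) ℝ) i j)).ofReal_comp)
  refine h.congr_deriv ?_
  simp [toComplex, symProd_apply, cayley_zero, Matrix.vecMulVec_apply]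

/-- A curve in the coadjoint orbit of `z = (p, m, u (1 - 3 n nᵀ))` whose velocity at `z` is
generated by `ζ`. -/
noncomputable def orbitCurve (u : Circle) (n : Fin 3 → ℝ) (z ζ : Triple) (t : ℝ) : Triple :=
  (z.1 + t * (diamond ζ.2.2 z.2.2).1,
    cayley ζ.2.1 t z.2.1 + t • cayley ζ.2.1 t (diamond ζ.2.2 z.2.2).2,
    uniaxial (Circle.exp (t * ζ.1) * u) (cayley ζ.2.1 t n))

theorem hasDerivAt_orbitCurve {u : Circle} {n : Fin 3 → ℝ} {z : Triple}
    (hz : z.2.2 = uniaxial u n) (ζ : Triple) :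
    HasDerivAt (orbitCurve u n z ζ) (coadVec ζ z) 0 := by
  refine HasDerivAt.prodMk ?_ (HasDerivAt.prodMk ?_ ?_)
  · simpa using ((hasDerivAt_id' (0 : ℝ)).mul_const (diamond ζ.2.2 z.2.2).1).const_add z.1
  · refine ((hasDerivAt_cayley ζ.2.1 z.2.1).add ((hasDerivAt_id' (0 : ℝ)).smul
      (hasDerivAt_cayley ζ.2.1 (diamond ζ.2.2 z.2.2).2))).congr_deriv ?_
    simp [cayley_zero]
  · rw [hz]
    exact hasDerivAt_uniaxial _ _ _ _

theorem orbitCurve_zero {u : Circle} {n : Fin 3 → ℝ} {z : Triple}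
    (hz : z.2.2 = uniaxial u n) (ζ : Triple) : orbitCurve u n z ζ 0 = z := by
  simp [orbitCurve, cayley_zero, ← hz]

/-- Momentum and axis are turned by the same rotation, and the added covector is orthogonal to n.
This keeps the curve inside the orbit. -/
theorem orbitCurve_dotProduct {u : Circle} {n : Fin 3 → ℝ} {z : Triple}
    (hz : z.2.2 = uniaxial u n) (ζ : Triple) (t : ℝ) :
    (orbitCurve u n z ζ t).2.1 ⬝ᵥ cayley ζ.2.1 t n = z.2.1 ⬝ᵥ n := by
  simp only [orbitCurve, add_dotProduct, smul_dotProduct, cayley_dotProduct]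
  rw [hz, diamond_dotProduct_eq_zero]
  simp

theorem orbitCurve_mem {p : ℝ} {m : Fin 3 → ℝ} {u : Circle} {n : Fin 3 → ℝ} {z : Triple}
    (hn : n ⬝ᵥ n = 1) (hm : z.2.1 ⬝ᵥ n = m 2) (hz : z.2.2 = uniaxial u n) (ζ : Triple) (t : ℝ) :
    orbitCurve u n z ζ t ∈ coadOrbit (p, m, baseMat) :=
  mem_coadOrbit_iff.2 ⟨_, _, by rw [cayley_dotProduct, hn], by
    rw [orbitCurve_dotProduct hz, hm], rfl⟩

/-- The differential of a function on the orbit is computed along curves. -/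
theorem hasDerivAt_comp_orbitCurve {p : ℝ} {m : Fin 3 → ℝ} {u : Circle} {n : Fin 3 → ℝ}
    {z : Triple} (hn : n ⬝ᵥ n = 1) (hm : z.2.1 ⬝ᵥ n = m 2) (hz : z.2.2 = uniaxial u n)
    {f : Triple → ℝ} (hf : DifferentiableWithinAt ℝ f (coadOrbit (p, m, baseMat)) z)
    (ζ : Triple) :
    HasDerivAt (fun t => f (orbitCurve u n z ζ t))
      (orbitDiff (coadOrbit (p, m, baseMat)) f z ζ) 0 := by
  have h := hf.hasFDerivWithinAt
  rw [← orbitCurve_zero hz ζ] at h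
  -- The whole curve lies in the orbit, so the chain rule applies to any chosen derivative within
  -- it.
  have h2 := HasFDerivWithinAt.comp_hasDerivWithinAt (s := Set.univ) 0 h
    (hasDerivAt_orbitCurve hz ζ).hasDerivWithinAt
    (fun t _ => orbitCurve_mem hn hm hz ζ t)
  rw [hasDerivWithinAt_univ, orbitCurve_zero hz ζ] at h2
  exact h2

/-! ### Smoothness -/

/-- The entry `nᵢ nⱼ`, as a polynomial in the entries of the matrix `u (1 - 3 n nᵀ)`. -/
noncomputable def axisProd (i j : Fin 3) (z : Triple) : ℝ :=
  (∑ k, ((z.2.2 i k).re * (z.2.2 j k).re + (z.2.2 i k).im * (z.2.2 j k).im) -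
    (1 : Matrix (Fin 3) (Fin 3) ℝ) i j) / 3

/-- The phase drops out of AA*, and (1 - 3nnᵀ)² = 1 + 3nnᵀ. -/
theorem axisProd_eq {u : Circle} {n : Fin 3 → ℝ} {z : Triple} (hn : n ⬝ᵥ n = 1)
    (hz : z.2.2 = uniaxial u n) (i j : Fin 3) : axisProd i j z = n i * n j := by
  have hu : (u : ℂ).re * (u : ℂ).re + (u : ℂ).im * (u : ℂ).im = 1 := by
    rw [← Complex.normSq_apply, Circle.normSq_coe]
  have h : ∀ k, (z.2.2 i k).re * (z.2.2 j k).re + (z.2.2 i k).im * (z.2.2 j k).im =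
      ((1 : Matrix (Fin 3) (Fin 3) ℝ) i k - 3 * (n i * n k)) *
      ((1 : Matrix (Fin 3) (Fin 3) ℝ) j k - 3 * (n j * n k)) := by
    intro k
    have e : ∀ a : Fin 3, z.2.2 a k = (u : ℂ) *
        (((1 : Matrix (Fin 3) (Fin 3) ℝ) a k - 3 * (n a * n k) : ℝ) : ℂ) := by
      intro a
      rw [hz]
      simp [uniaxial, toComplex, Matrix.vecMulVec_apply]
    rw [e, e, Complex.re_mul_ofReal, Complex.re_mul_ofReal, Complex.im_mul_ofReal,
      Complex.im_mul_ofReal]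
    linear_combination (((1 : Matrix (Fin 3) (Fin 3) ℝ) i k - 3 * (n i * n k)) *
      ((1 : Matrix (Fin 3) (Fin 3) ℝ) j k - 3 * (n j * n k))) * hu
  simp only [axisProd, h]
  simp only [dotProduct, Fin.sum_univ_three] at hn ⊢
  simp only [Matrix.one_apply]
  have h3 : 3 * (n i * n j) * (n 0 * n 0 + n 1 * n 1 + n 2 * n 2) = 3 * (n i * n j) := by
    rw [hn, mul_one]
  clear h hz
  fin_cases i <;> fin_cases j <;> simp at h3 ⊢ <;> linear_combination h3

theorem contDiff_axisProd (i j : Fin 3) : ContDiff ℝ ∞ (axisProd i j) := by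
  have h : ∀ i k : Fin 3, ContDiff ℝ ∞ fun z : Triple => z.2.2 i k := fun i k =>
    (contDiff_apply_apply ℝ ℂ i k).comp (contDiff_snd.comp contDiff_snd)
  have hr : ∀ i k : Fin 3, ContDiff ℝ ∞ fun z : Triple => (z.2.2 i k).re := fun i k =>
    Complex.reCLM.contDiff.comp (h i k)
  have hi : ∀ i k : Fin 3, ContDiff ℝ ∞ fun z : Triple => (z.2.2 i k).im := fun i k =>
    Complex.imCLM.contDiff.comp (h i k)
  exact ((ContDiff.sum fun k _ => ((hr i k).mul (hr j k)).add ((hi i k).mul (hi j k))).sub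
    contDiff_const).div_const 3

/-- The square of `(m × n)₃` as a polynomial function of `(p, m, A)`. -/
noncomputable def axialTorqueSq (z : Triple) : ℝ :=
  z.2.1 0 ^ 2 * axisProd 1 1 z - 2 * (z.2.1 0 * z.2.1 1) * axisProd 0 1 z +
    z.2.1 1 ^ 2 * axisProd 0 0 z

theorem axialTorqueSq_eq {u : Circle} {n : Fin 3 → ℝ} {z : Triple} (hn : n ⬝ᵥ n = 1)
    (hz : z.2.2 = uniaxial u n) : axialTorqueSq z = (crossProduct z.2.1 n 2) ^ 2 := by
  rw [axialTorqueSq, axisProd_eq hn hz, axisProd_eq hn hz, axisProd_eq hn hz, cross_apply_two]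
  ring

theorem contDiff_momentum (i : Fin 3) : ContDiff ℝ ∞ fun z : Triple => z.2.1 i :=
  (contDiff_apply ℝ ℝ i).comp (contDiff_fst.comp contDiff_snd)

theorem contDiff_axialTorqueSq : ContDiff ℝ ∞ axialTorqueSq := by
  have h := contDiff_momentum
  have hP := contDiff_axisProd
  exact ((((h 0).pow 2).mul (hP 1 1)).sub ((contDiff_const.mul ((h 0).mul (h 1))).mul
    (hP 0 1))).add (((h 1).pow 2).mul (hP 0 0))

/-- On the orbit h coincides with a rational function on the ambient space: it is even in n, so n
enters through `axisProd`, and m'·n may be replaced by the constant `m 2`. -/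
theorem contDiffOn_hamiltonian {γ : Fin 3 → ℝ} (hg : 0 < γ 0) (hd : 0 < γ 1 + γ 2)
    (p : ℝ) (m : Fin 3 → ℝ) :
    ContDiffOn ℝ ∞ (hamiltonian γ) (coadOrbit (p, m, baseMat)) := by
  have h := contDiff_momentum
  have hP := contDiff_axisProd 2 2
  have hd1 : ContDiff ℝ ∞ fun z : Triple =>
      4 * (6 * γ 0 + (γ 1 + γ 2) * (1 + 3 * axisProd 2 2 z)) :=
    contDiff_const.mul (contDiff_const.add (contDiff_const.mul
      (contDiff_const.add (contDiff_const.mul hP))))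
  have hd2 : ContDiff ℝ ∞ fun z : Triple =>
      36 * (2 * γ 0 + (γ 1 + γ 2) * axisProd 2 2 z) :=
    contDiff_const.mul (contDiff_const.add (contDiff_const.mul hP))
  have hn1 : ContDiff ℝ ∞ fun z : Triple => z.1 ^ 2 := contDiff_fst.pow 2
  have hn2 : ContDiff ℝ ∞ fun z : Triple => z.2.1 ⬝ᵥ z.2.1 - m 2 ^ 2 -
      (γ 1 + γ 2) / (2 * γ 0 + (γ 1 + γ 2)) * axialTorqueSq z :=
    ((ContDiff.sum fun i _ => (h i).mul (h i)).sub contDiff_const).sub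
      (contDiff_const.mul contDiff_axialTorqueSq)
  have hpos : ∀ z ∈ coadOrbit (p, m, baseMat), 0 ≤ axisProd 2 2 z := by
    intro z hz
    obtain ⟨u, n, hn, -, hA⟩ := mem_coadOrbit_iff.1 hz
    rw [axisProd_eq hn hA]
    exact mul_self_nonneg _
  refine ((hn1.contDiffOn.div hd1.contDiffOn ?_).add
    (hn2.contDiffOn.div hd2.contDiffOn ?_)).congr ?_
  · intro z hz
    have := hpos z hz
    positivity
  · intro z hz
    have := hpos z hz
    positivity
  · intro z hz
    obtain ⟨u, n, hn, hm, hA⟩ := mem_coadOrbit_iff.1 hz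
    simp only [hamiltonian_eq hg hd hn hA, reducedHamiltonian, Pi.div_apply, axisProd_eq hn hA,
      axialTorqueSq_eq hn hA, hm, sq]

theorem contDiffOn_circleMomentum {γ : Fin 3 → ℝ} (hg : 0 < γ 0) (hd : 0 < γ 1 + γ 2)
    (p : ℝ) (m : Fin 3 → ℝ) :
    ContDiffOn ℝ ∞ (circleMomentum γ) (coadOrbit (p, m, baseMat)) := by
  refine contDiff_fst.contDiffOn.congr fun z hz => ?_
  obtain ⟨u, n, hn, -, hA⟩ := mem_coadOrbit_iff.1 hz
  exact circleMomentum_eq hg hd hn hA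

theorem rotationMomentum_eq (z : Triple) : rotationMomentum z = z.2.1 2 := by
  simp [rotationMomentum, basisVec]

theorem contDiff_rotationMomentum : ContDiff ℝ ∞ rotationMomentum := by
  rw [funext rotationMomentum_eq]
  exact contDiff_momentum 2

/-! ### Involution -/

theorem differentiableWithinAt_of_contDiffOn {O : Set Triple} {f : Triple → ℝ}
    (h : ContDiffOn ℝ ∞ f O) {z : Triple} (hz : z ∈ O) : DifferentiableWithinAt ℝ f O z :=
  (h z hz).differentiableWithinAt (by simp)

theorem mem_lieAlg_of_mem_coadOrbit {p : ℝ} {m : Fin 3 → ℝ} {z : Triple}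
    (hz : z ∈ coadOrbit (p, m, baseMat)) : z ∈ lieAlg := by
  obtain ⟨u, n, hn, -, hA⟩ := mem_coadOrbit_iff.1 hz
  rw [mem_lieAlg, hA]
  exact uniaxial_mem hn u

theorem orbitDiff_circleMomentum {γ : Fin 3 → ℝ} (hg : 0 < γ 0) (hd : 0 < γ 1 + γ 2)
    {p : ℝ} {m : Fin 3 → ℝ} {z : Triple} (hz : z ∈ coadOrbit (p, m, baseMat)) (ζ : Triple) :
    orbitDiff (coadOrbit (p, m, baseMat)) (circleMomentum γ) z ζ = (coadVec ζ z).1 := by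
  obtain ⟨u, n, hn, hm, hA⟩ := mem_coadOrbit_iff.1 hz
  have h := hasDerivAt_comp_orbitCurve hn hm hA (differentiableWithinAt_of_contDiffOn
    (contDiffOn_circleMomentum hg hd p m) hz) ζ
  refine h.unique ?_
  have : (fun t => circleMomentum γ (orbitCurve u n z ζ t)) =
      fun t => (orbitCurve u n z ζ t).1 := by
    ext t
    exact circleMomentum_eq hg hd (by rw [cayley_dotProduct, hn]) rfl
  rw [this]
  exact (hasFDerivAt_fst (𝕜 := ℝ)).comp_hasDerivAt 0 (hasDerivAt_orbitCurve hA ζ)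

theorem orbitDiff_rotationMomentum {p : ℝ} {m : Fin 3 → ℝ} {z : Triple}
    (hz : z ∈ coadOrbit (p, m, baseMat)) (ζ : Triple) :
    orbitDiff (coadOrbit (p, m, baseMat)) rotationMomentum z ζ = (coadVec ζ z).2.1 2 := by
  obtain ⟨u, n, hn, hm, hA⟩ := mem_coadOrbit_iff.1 hz
  have h := hasDerivAt_comp_orbitCurve hn hm hA (differentiableWithinAt_of_contDiffOn
    (contDiff_rotationMomentum.contDiffOn (s := coadOrbit (p, m, baseMat))) hz) ζ
  refine h.unique ?_
  simp only [rotationMomentum_eq]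
  have h2 : HasDerivAt (fun t => (orbitCurve u n z ζ t).2.1) (coadVec ζ z).2.1 0 :=
    ((ContinuousLinearMap.fst ℝ (Fin 3 → ℝ) Mat3).comp
      (ContinuousLinearMap.snd ℝ ℝ ((Fin 3 → ℝ) × Mat3))).hasFDerivAt.comp_hasDerivAt 0
        (hasDerivAt_orbitCurve hA ζ)
  exact hasDerivAt_pi.1 h2 2

theorem isHamiltonianAt_circleMomentum {γ : Fin 3 → ℝ} (hg : 0 < γ 0) (hd : 0 < γ 1 + γ 2)
    {p : ℝ} {m : Fin 3 → ℝ} {z : Triple} (hz : z ∈ coadOrbit (p, m, baseMat)) :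
    IsHamiltonianAt (coadOrbit (p, m, baseMat)) (circleMomentum γ) z (-(1, 0, 0)) := by
  refine isHamiltonianAt_neg_of_pairing (mem_lieAlg.2 (zero_mem _)) fun η _ => ?_
  rw [orbitDiff_circleMomentum hg hd hz]
  simp [pairing, matPair_zero_right]

theorem isHamiltonianAt_rotationMomentum {p : ℝ} {m : Fin 3 → ℝ} {z : Triple}
    (hz : z ∈ coadOrbit (p, m, baseMat)) :
    IsHamiltonianAt (coadOrbit (p, m, baseMat)) rotationMomentum z (-(0, basisVec 2, 0)) := by
  refine isHamiltonianAt_neg_of_pairing (mem_lieAlg.2 (zero_mem _)) fun η _ => ?_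
  rw [orbitDiff_rotationMomentum hz]
  simp [pairing, matPair_zero_right, basisVec]

theorem hamiltonian_orbitCurve {γ : Fin 3 → ℝ} (hg : 0 < γ 0) (hd : 0 < γ 1 + γ 2)
    {u : Circle} {n : Fin 3 → ℝ} {z : Triple} (hn : n ⬝ᵥ n = 1) (hz : z.2.2 = uniaxial u n)
    (ζ : Triple) (t : ℝ) :
    hamiltonian γ (orbitCurve u n z ζ t) = reducedHamiltonian (γ 0) (γ 1 + γ 2) (z.2.1 ⬝ᵥ n)
      (orbitCurve u n z ζ t).1 (orbitCurve u n z ζ t).2.1 (cayley ζ.2.1 t n) := by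
  rw [hamiltonian_eq (n := cayley ζ.2.1 t n) hg hd (by rw [cayley_dotProduct, hn]) rfl,
    orbitCurve_dotProduct hz]

theorem orbitDiff_hamiltonian_circle {γ : Fin 3 → ℝ} (hg : 0 < γ 0) (hd : 0 < γ 1 + γ 2)
    {p : ℝ} {m : Fin 3 → ℝ} {z : Triple} (hz : z ∈ coadOrbit (p, m, baseMat)) :
    orbitDiff (coadOrbit (p, m, baseMat)) (hamiltonian γ) z (-(1, 0, 0)) = 0 := by
  obtain ⟨u, n, hn, hm, hA⟩ := mem_coadOrbit_iff.1 hz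
  have h := hasDerivAt_comp_orbitCurve hn hm hA (differentiableWithinAt_of_contDiffOn
    (contDiffOn_hamiltonian hg hd p m) hz) (-(1, 0, 0))
  refine h.unique ?_
  simp only [hamiltonian_orbitCurve hg hd hn hA]
  simp only [orbitCurve, Prod.neg_mk, neg_zero, diamond_zero, cayley_zero_left]
  simpa using hasDerivAt_const (0 : ℝ) _

theorem cayley_axis_two (s t : ℝ) (x : Fin 3 → ℝ) : cayley (s • basisVec 2) t x 2 = x 2 := by
  simp [cayley, basisVec, cross_apply]

/-- Up to sign, (x × y)₃ is the inner product of x with the quarter turn (-y₁, y₀, 0), which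
commutes with rotations about e₃. -/
theorem cross_cayley_axis_two (s t : ℝ) (x y : Fin 3 → ℝ) :
    crossProduct (cayley (s • basisVec 2) t x) (cayley (s • basisVec 2) t y) 2 =
      crossProduct x y 2 := by
  have h := cayley_dotProduct (s • basisVec 2) t x ![-y 1, y 0, 0]
  have h2 := cayley_axis_two s t ![-y 1, y 0, 0]
  have e0 : cayley (s • basisVec 2) t ![-y 1, y 0, 0] 0 = -cayley (s • basisVec 2) t y 1 := by
    simp [cayley, basisVec, cross_apply]
    ring
  have e1 : cayley (s • basisVec 2) t ![-y 1, y 0, 0] 1 = cayley (s • basisVec 2) t y 0 := by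
    simp [cayley, basisVec, cross_apply]
  rw [cross_apply_two, cross_apply_two]
  simp only [dotProduct, Fin.sum_univ_three, h2, e0, e1] at h
  simp at h
  linarith

/-- Turning m and n together about e₃ preserves |m|, n₃ and (m × n)₃, so h is constant along the
curve. -/
theorem orbitDiff_hamiltonian_rotation {γ : Fin 3 → ℝ} (hg : 0 < γ 0) (hd : 0 < γ 1 + γ 2)
    {p : ℝ} {m : Fin 3 → ℝ} {z : Triple} (hz : z ∈ coadOrbit (p, m, baseMat)) :
    orbitDiff (coadOrbit (p, m, baseMat)) (hamiltonian γ) z (-(0, basisVec 2, 0)) = 0 := by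
  obtain ⟨u, n, hn, hm, hA⟩ := mem_coadOrbit_iff.1 hz
  have h := hasDerivAt_comp_orbitCurve hn hm hA (differentiableWithinAt_of_contDiffOn
    (contDiffOn_hamiltonian hg hd p m) hz) (-(0, basisVec 2, 0))
  refine h.unique ?_
  have e : -basisVec 2 = (-1 : ℝ) • basisVec 2 := by simp
  have e2 : ∀ t, cayley ((-1 : ℝ) • basisVec 2) t 0 = 0 := by
    intro t
    simp [cayley]
  simp only [hamiltonian_orbitCurve hg hd hn hA]
  simp only [orbitCurve, Prod.neg_mk, neg_zero, diamond_zero, Prod.fst_zero, Prod.snd_zero,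
    mul_zero, add_zero, e, e2, smul_zero, reducedHamiltonian, cayley_axis_two,
    cross_cayley_axis_two, cayley_dotProduct]
  exact hasDerivAt_const (0 : ℝ) _

theorem orbitDiff_circleMomentum_rotation {γ : Fin 3 → ℝ} (hg : 0 < γ 0) (hd : 0 < γ 1 + γ 2)
    {p : ℝ} {m : Fin 3 → ℝ} {z : Triple} (hz : z ∈ coadOrbit (p, m, baseMat)) :
    orbitDiff (coadOrbit (p, m, baseMat)) (circleMomentum γ) z (-(0, basisVec 2, 0)) = 0 := by
  rw [orbitDiff_circleMomentum hg hd hz]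
  simp [coadVec, diamond_zero]

theorem involution {γ : Fin 3 → ℝ} (hg : 0 < γ 0) (hd : 0 < γ 1 + γ 2) {p : ℝ}
    {m : Fin 3 → ℝ} (i j : Fin 3) {z : Triple} (hz : z ∈ coadOrbit (p, m, baseMat)) :
    IsPoissonBracketAt (coadOrbit (p, m, baseMat))
      ((![hamiltonian γ, circleMomentum γ, rotationMomentum] : Fin 3 → Triple → ℝ) i)
      ((![hamiltonian γ, circleMomentum γ, rotationMomentum] : Fin 3 → Triple → ℝ) j) z 0 := by
  have hz' := mem_lieAlg_of_mem_coadOrbit hz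
  have h01 := isPoissonBracketAt_zero hz' (isHamiltonianAt_circleMomentum hg hd hz)
    (orbitDiff_hamiltonian_circle hg hd hz)
  have h02 := isPoissonBracketAt_zero hz' (isHamiltonianAt_rotationMomentum hz)
    (orbitDiff_hamiltonian_rotation hg hd hz)
  have h12 := isPoissonBracketAt_zero hz' (isHamiltonianAt_rotationMomentum hz)
    (orbitDiff_circleMomentum_rotation hg hd hz)
  fin_cases i <;> fin_cases j
  exacts [isPoissonBracketAt_self _ hz', h01, h02, h01.swap, isPoissonBracketAt_self _ hz', h12,
    h02.swap, h12.swap, isPoissonBracketAt_self _ hz']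

/-! ### The dimension of the orbits -/

/-- The plane orthogonal to `n`. -/
def normalPlane (n : Fin 3 → ℝ) : Submodule ℝ (Fin 3 → ℝ) :=
  LinearMap.ker
    ({ toFun := fun x => x ⬝ᵥ n
       map_add' := fun x y => add_dotProduct x y n
       map_smul' := fun c x => smul_dotProduct c x n } : Module.Dual ℝ (Fin 3 → ℝ))

theorem mem_normalPlane {n x : Fin 3 → ℝ} : x ∈ normalPlane n ↔ x ⬝ᵥ n = 0 := Iff.rfl

theorem finrank_normalPlane {n : Fin 3 → ℝ} (hn : n ⬝ᵥ n = 1) :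
    Module.finrank ℝ (normalPlane n) = 2 := by
  have h := Module.Dual.finrank_ker_add_one_of_ne_zero (K := ℝ) (V₁ := Fin 3 → ℝ)
    (f := { toFun := fun x => x ⬝ᵥ n
            map_add' := fun x y => add_dotProduct x y n
            map_smul' := fun c x => smul_dotProduct c x n })
    (fun h => by
      have := LinearMap.congr_fun h n
      simp [hn] at this)
  rw [Module.finrank_fin_fun] at h
  rw [normalPlane]
  omega

/-- The tangent vectors of the orbit are parametrized by a horizontal element of the Lie algebra and
a covector annihilating the isotropy algebra. -/
noncomputable def tangentParam (n : Fin 3 → ℝ) (z : Triple) :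
    ((ℝ × normalPlane n) × (ℝ × normalPlane n)) →ₗ[ℝ] Triple where
  toFun q := (q.2.1, crossProduct (q.1.2 : Fin 3 → ℝ) z.2.1 + q.2.2, infAct (q.1.1, q.1.2) z.2.2)
  map_add' q r := by
    have := infAct_add_left (q.1.1, q.1.2) (r.1.1, r.1.2) z.2.2
    simp only [Prod.fst_add, Prod.snd_add, Submodule.coe_add, map_add, LinearMap.add_apply,
      Prod.mk_add_mk] at this ⊢
    rw [this, add_add_add_comm]
  map_smul' c q := by
    have := infAct_smul_left c (q.1.1, q.1.2) z.2.2
    simp only [Prod.smul_fst, Prod.smul_snd, Submodule.coe_smul, map_smul, LinearMap.smul_apply,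
      Prod.smul_mk, RingHom.id_apply, smul_add] at this ⊢
    rw [this]

theorem tangentParam_injective {u : Circle} {n : Fin 3 → ℝ} {z : Triple} (hn : n ⬝ᵥ n = 1)
    (hz : z.2.2 = uniaxial u n) : Function.Injective (tangentParam n z) := by
  rw [injective_iff_map_eq_zero]
  rintro ⟨⟨v, w, hw⟩, x, y, hy⟩ h
  simp only [tangentParam, LinearMap.coe_mk, AddHom.coe_mk, Prod.mk_eq_zero, hz] at h
  obtain ⟨h1, h2, h3⟩ := h
  obtain ⟨h4, h5⟩ := infAct_uniaxial_eq_zero hn h3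
  have hw0 : w = 0 := by rw [← cross_cross_self' hn hw, h5, map_zero]
  subst hw0
  simp only [map_zero, LinearMap.zero_apply, zero_add] at h2
  simp only [Prod.mk_eq_zero, Submodule.mk_eq_zero]
  exact ⟨⟨h4, trivial⟩, h1, h2⟩

theorem orbitTangent_eq_range {u : Circle} {n : Fin 3 → ℝ} {z : Triple} (hn : n ⬝ᵥ n = 1)
    (hz : z.2.2 = uniaxial u n) : orbitTangent z = LinearMap.range (tangentParam n z) := by
  apply le_antisymm
  · rw [orbitTangent, Submodule.span_le]
    rintro _ ⟨⟨v, w, U⟩, -, rfl⟩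
    have hw : w - (w ⬝ᵥ n) • n ∈ normalPlane n := by
      rw [mem_normalPlane, sub_dotProduct, smul_dotProduct, hn, smul_eq_mul, mul_one, sub_self]
    have hy : (w ⬝ᵥ n) • crossProduct n z.2.1 + (diamond U z.2.2).2 ∈ normalPlane n := by
      rw [mem_normalPlane, add_dotProduct, smul_dotProduct, hz, diamond_dotProduct_eq_zero,
        dotProduct_comm (crossProduct n _) n, dot_self_cross, smul_zero, add_zero]
    -- The part of w along n fixes the matrix and moves the momentum orthogonally to n, so it is
    -- absorbed into the covector.
    refine ⟨⟨⟨v, ⟨_, hw⟩⟩, (diamond U z.2.2).1, ⟨_, hy⟩⟩, ?_⟩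
    have e : infAct (v, w) z.2.2 = infAct (v, w - (w ⬝ᵥ n) • n) z.2.2 := by
      have : (v, w) = (v, w - (w ⬝ᵥ n) • n) + (w ⬝ᵥ n) • ((0 : ℝ), n) := by simp
      conv_lhs => rw [this]
      rw [infAct_add_left, infAct_smul_left, hz, infAct_uniaxial_self, smul_zero, add_zero]
    simp only [tangentParam, LinearMap.coe_mk, AddHom.coe_mk, coadVec, ← e, map_sub, map_smul,
      LinearMap.sub_apply, LinearMap.smul_apply]
    congr 2
    abel
  · rintro _ ⟨⟨⟨v, w, hw⟩, x, y, hy⟩, rfl⟩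
    obtain ⟨U, hU, h⟩ := exists_diamond_eq hn u x hy
    refine Submodule.subset_span ⟨(v, w, U), mem_lieAlg.2 hU, ?_⟩
    simp only [tangentParam, LinearMap.coe_mk, AddHom.coe_mk, coadVec, hz, h]

theorem finrank_orbitTangent {p : ℝ} {m : Fin 3 → ℝ} {z : Triple}
    (hz : z ∈ coadOrbit (p, m, baseMat)) : Module.finrank ℝ (orbitTangent z) = 6 := by
  obtain ⟨u, n, hn, -, hA⟩ := mem_coadOrbit_iff.1 hz
  rw [orbitTangent_eq_range hn hA, LinearMap.finrank_range_of_inj (tangentParam_injective hn hA)]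
  simp [Module.finrank_prod, finrank_normalPlane hn]

/-! ### Independence -/

theorem orbitCurve_vertical {u : Circle} {n : Fin 3 → ℝ} {z : Triple}
    (hz : z.2.2 = uniaxial u n) (U : Mat3) (t : ℝ) :
    orbitCurve u n z (0, 0, U) t = (z.1 + t * (diamond U z.2.2).1,
      z.2.1 + t • (diamond U z.2.2).2, z.2.2) := by
  simp [orbitCurve, cayley_zero_left, ← hz]

/-- With k = (m × n)₃, the direction n × e₃ gives δ|m|² = 2k and δk = 1 - n₃². The factor 2g + dn₃²
then cancels. -/
theorem hasDerivAt_reducedHamiltonian {g d : ℝ} (hg : 0 < g) (hd : 0 < d) (c p : ℝ)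
    (m : Fin 3 → ℝ) {n : Fin 3 → ℝ} (hn : n ⬝ᵥ n = 1) :
    HasDerivAt (fun t : ℝ => reducedHamiltonian g d c p (m + t • crossProduct n (basisVec 2)) n)
      (crossProduct m n 2 / (18 * (2 * g + d))) 0 := by
  simp only [dotProduct, Fin.sum_univ_three] at hn
  set k := crossProduct m n 2 with hk
  set q := crossProduct n (basisVec 2) ⬝ᵥ crossProduct n (basisVec 2) with hq
  have h1 : ∀ t : ℝ, (m + t • crossProduct n (basisVec 2)) ⬝ᵥ
      (m + t • crossProduct n (basisVec 2)) = m ⬝ᵥ m + t * (2 * k) + t ^ 2 * q := by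
    intro t
    rw [hq, hk, cross_apply_two]
    simp [cross_apply, basisVec, dotProduct, Fin.sum_univ_three]
    ring
  have h2 : ∀ t : ℝ, crossProduct (m + t • crossProduct n (basisVec 2)) n 2 =
      k + t * (1 - n 2 ^ 2) := by
    intro t
    rw [hk, cross_apply_two, cross_apply_two]
    simp [cross_apply, basisVec]
    linear_combination t * hn
  simp only [reducedHamiltonian, h1, h2]
  have hi := hasDerivAt_id' (0 : ℝ)
  refine ((((((hi.mul_const (2 * k)).const_add (m ⬝ᵥ m)).add
    ((hi.pow 2).mul_const q)).sub_const (c ^ 2)).sub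
    ((((hi.mul_const (1 - n 2 ^ 2)).const_add k).pow 2).const_mul (d / (2 * g + d)))).div_const
      (36 * (2 * g + d * n 2 ^ 2)) |>.const_add
        (p ^ 2 / (4 * (6 * g + d * (1 + 3 * n 2 ^ 2))))).congr_deriv ?_
  have e1 : 2 * g + d * n 2 ^ 2 ≠ 0 := by positivity
  have e2 : 2 * g + d ≠ 0 := by positivity
  simp
  field_simp
  ring

theorem differentials_independent {γ : Fin 3 → ℝ} (hg : 0 < γ 0) (hd : 0 < γ 1 + γ 2) {p : ℝ}
    {m : Fin 3 → ℝ} {z : Triple} (hz : z ∈ coadOrbit (p, m, baseMat)) (hk : axialTorqueSq z ≠ 0)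
    {c : Fin 3 → ℝ} (h : ∀ ζ ∈ lieAlg,
      c 0 * orbitDiff (coadOrbit (p, m, baseMat)) (hamiltonian γ) z ζ +
      c 1 * orbitDiff (coadOrbit (p, m, baseMat)) (circleMomentum γ) z ζ +
      c 2 * orbitDiff (coadOrbit (p, m, baseMat)) rotationMomentum z ζ = 0) : c = 0 := by
  obtain ⟨u, n, hn, hm, hA⟩ := mem_coadOrbit_iff.1 hz
  rw [axialTorqueSq_eq hn hA] at hk
  have hk' : crossProduct z.2.1 n 2 ≠ 0 := fun h0 => hk (by rw [h0]; norm_num)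
  have hvert : ∀ (x : ℝ) (y : Fin 3 → ℝ), y ⬝ᵥ n = 0 → ∃ U ∈ symTraceless,
      diamond U z.2.2 = (x, y) := fun x y hy => by
    rw [hA]; exact exists_diamond_eq hn u x hy
  have hj : ∀ ζ, orbitDiff (coadOrbit (p, m, baseMat)) (circleMomentum γ) z ζ =
    (coadVec ζ z).1 := orbitDiff_circleMomentum hg hd hz
  have hr : ∀ ζ, orbitDiff (coadOrbit (p, m, baseMat)) rotationMomentum z ζ =
    (coadVec ζ z).2.1 2 := orbitDiff_rotationMomentum hz
  have c0 : c 0 = 0 := by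
    obtain ⟨U, hU, hUd⟩ := hvert 0 (crossProduct n (basisVec 2))
      (by rw [dotProduct_comm, dot_self_cross])
    have h1 := h (0, 0, U) (mem_lieAlg.2 hU)
    have h2 := hasDerivAt_comp_orbitCurve hn hm hA (differentiableWithinAt_of_contDiffOn
      (contDiffOn_hamiltonian hg hd p m) hz) (0, 0, U)
    simp only [hamiltonian_orbitCurve hg hd hn hA] at h2
    simp only [orbitCurve_vertical hA, cayley_zero_left, hUd, mul_zero, add_zero] at h2
    rw [h2.unique (hasDerivAt_reducedHamiltonian hg hd _ _ _ hn), hj, hr] at h1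
    simp only [coadVec, hUd, map_zero, LinearMap.zero_apply, zero_add, mul_zero, add_zero] at h1
    have h3 : crossProduct n (basisVec 2) 2 = 0 := by simp [cross_apply, basisVec]
    rw [h3, mul_zero, add_zero] at h1
    rcases mul_eq_zero.1 h1 with h4 | h4
    · exact h4
    · exact absurd h4 (div_ne_zero hk' (by positivity))
  have c1 : c 1 = 0 := by
    obtain ⟨U, hU, hUd⟩ := hvert 1 0 (zero_dotProduct n)
    have h1 := h (0, 0, U) (mem_lieAlg.2 hU)
    rw [c0, hj, hr] at h1
    simpa [coadVec, hUd] using h1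
  have c2 : c 2 = 0 := by
    obtain ⟨U, hU, hUd⟩ := hvert 0 (basisVec 2 - n 2 • n) (by
      rw [sub_dotProduct, smul_dotProduct, hn]
      simp [basisVec])
    have h1 := h (0, 0, U) (mem_lieAlg.2 hU)
    rw [c0, c1, hj, hr] at h1
    have h2 : c 2 = 0 ∨ 1 - n 2 * n 2 = 0 := by
      simpa [coadVec, hUd, basisVec] using h1
    -- If n₃² = 1 then n is parallel to e₃, and (m × n)₃ would vanish.
    refine h2.resolve_right fun h3 => hk' ?_
    simp only [dotProduct, Fin.sum_univ_three] at hn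
    have n0 : n 0 = 0 := by nlinarith [mul_self_nonneg (n 0), mul_self_nonneg (n 1)]
    have n1 : n 1 = 0 := by nlinarith [mul_self_nonneg (n 0), mul_self_nonneg (n 1)]
    rw [cross_apply_two, n0, n1]
    ring
  ext i
  fin_cases i <;> assumption

/-! ### Density -/

theorem mem_closure_of_curve {S : Set Triple} {f : ℝ → Triple} (hf : ContinuousAt f 0)
    (h : ∀ t ≠ 0, f t ∈ S) : f 0 ∈ closure S :=
  mem_closure_of_tendsto (hf.tendsto.mono_left (nhdsWithin_le_nhds (s := {0}ᶜ)))
    (Filter.eventually_of_mem self_mem_nhdsWithin h)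

/-- Two perturbations are composed. Away from the poles n = ±e₃, shifting the momentum by t(n × e₃)
makes (m × n)₃ nonzero; a pole is left by a rotation about the first axis. -/
theorem coadOrbit_subset_closure (p : ℝ) (m : Fin 3 → ℝ) :
    coadOrbit (p, m, baseMat) ⊆
      closure (coadOrbit (p, m, baseMat) ∩ {z | axialTorqueSq z ≠ 0}) := by
  have h1 : coadOrbit (p, m, baseMat) ∩ {z | axisProd 2 2 z ≠ 1} ⊆
      closure (coadOrbit (p, m, baseMat) ∩ {z | axialTorqueSq z ≠ 0}) := by
    rintro z ⟨hz, hz2⟩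
    by_cases hk : axialTorqueSq z = 0
    swap
    · exact subset_closure ⟨hz, hk⟩
    obtain ⟨u, n, hn, hm, hA⟩ := mem_coadOrbit_iff.1 hz
    obtain ⟨U, hU, hUd⟩ := exists_diamond_eq hn u 0 (y := crossProduct n (basisVec 2))
      (by rw [dotProduct_comm, dot_self_cross])
    rw [← hA] at hUd
    have h0 := orbitCurve_zero hA (0, 0, U)
    rw [← h0]
    refine mem_closure_of_curve (hasDerivAt_orbitCurve hA _).continuousAt fun t ht =>
      ⟨orbitCurve_mem hn hm hA _ t, ?_⟩
    rw [axialTorqueSq_eq hn hA] at hk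
    rw [Set.mem_ofPred_eq, axisProd_eq hn hA] at hz2
    have hk' : crossProduct z.2.1 n 2 = 0 := by simpa using hk
    rw [Set.mem_ofPred_eq, orbitCurve_vertical hA, axialTorqueSq_eq hn (by exact hA)]
    have e : crossProduct (z.2.1 + t • crossProduct n (basisVec 2)) n 2 = t * (1 - n 2 * n 2) := by
      simp only [dotProduct, Fin.sum_univ_three] at hn
      rw [cross_apply_two] at hk' ⊢
      simp [cross_apply, basisVec]
      linear_combination t * hn + hk'
    simp only [hUd]
    rw [e]
    exact pow_ne_zero _ (mul_ne_zero ht (sub_ne_zero.2 (Ne.symm hz2)))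
  have h2 : coadOrbit (p, m, baseMat) ⊆
      closure (coadOrbit (p, m, baseMat) ∩ {z | axisProd 2 2 z ≠ 1}) := by
    intro z hz
    by_cases hk : axisProd 2 2 z = 1
    swap
    · exact subset_closure ⟨hz, hk⟩
    obtain ⟨u, n, hn, hm, hA⟩ := mem_coadOrbit_iff.1 hz
    have h0 := orbitCurve_zero hA (0, basisVec 0, 0)
    rw [← h0]
    refine mem_closure_of_curve (hasDerivAt_orbitCurve hA _).continuousAt fun t ht =>
      ⟨orbitCurve_mem hn hm hA _ t, ?_⟩
    rw [axisProd_eq hn hA] at hk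
    have hn' := cayley_dotProduct (basisVec 0) t n n
    rw [Set.mem_ofPred_eq, axisProd_eq (n := cayley (basisVec 0) t n) (by rw [hn', hn]) rfl]
    rw [hn] at hn'
    simp only [dotProduct, Fin.sum_univ_three] at hn hn'
    have n0 : n 0 = 0 := by nlinarith [mul_self_nonneg (n 0), mul_self_nonneg (n 1)]
    have n1 : n 1 = 0 := by nlinarith [mul_self_nonneg (n 0), mul_self_nonneg (n 1)]
    have n2 : n 2 ≠ 0 := by rintro h; rw [h] at hk; norm_num at hk
    have e : cayley (basisVec 0) t n 1 ≠ 0 := by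
      have h3 := cayley_denom_pos (basisVec 0) t
      have : cayley (basisVec 0) t n 1 =
          (t / (1 + t ^ 2 * (basisVec 0 ⬝ᵥ basisVec 0) / 4)) * (-n 2) := by
        rw [cayley]
        simp [cross_apply, n1, basisVec]
      rw [this]
      exact mul_ne_zero (div_ne_zero ht h3.ne') (neg_ne_zero.2 n2)
    intro h3
    exact e (by nlinarith [mul_self_nonneg (cayley (basisVec 0) t n 0),
      mul_self_nonneg (cayley (basisVec 0) t n 1)])
  exact h2.trans (closure_minimal h1 isClosed_closure)

/-! ### The complement has measure zero -/

theorem exists_angle {x y : ℝ} (h : x ^ 2 + y ^ 2 = 1) :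
    ∃ θ : ℝ, x = Real.cos θ ∧ y = Real.sin θ := by
  have hn : ‖(⟨x, y⟩ : ℂ)‖ = 1 := by
    rw [Complex.norm_def, Complex.normSq_mk, ← sq, ← sq, h, Real.sqrt_one]
  refine ⟨Complex.arg ⟨x, y⟩, ?_, ?_⟩
  · have := Complex.norm_mul_cos_arg ⟨x, y⟩
    rw [hn, one_mul] at this
    exact this.symm
  · have := Complex.norm_mul_sin_arg ⟨x, y⟩
    rw [hn, one_mul] at this
    exact this.symm

theorem contDiff_uniaxial {E : Type*} [NormedAddCommGroup E] [NormedSpace ℝ E] {φ : E → ℝ}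
    {n : E → Fin 3 → ℝ} (hφ : ContDiff ℝ 1 φ) (hn : ContDiff ℝ 1 n) :
    ContDiff ℝ 1 fun x => uniaxial (Circle.exp (φ x)) (n x) := by
  have h1 : ContDiff ℝ 1 fun x => Complex.exp ((φ x : ℂ) * Complex.I) :=
    ((Complex.ofRealCLM.contDiff.comp hφ).mul contDiff_const).cexp
  refine contDiff_pi.2 fun i => contDiff_pi.2 fun j => ?_
  have h2 : ContDiff ℝ 1 fun x => (((1 : Matrix (Fin 3) (Fin 3) ℝ) i j -
      3 * (n x i * n x j) : ℝ) : ℂ) :=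
    Complex.ofRealCLM.contDiff.comp (contDiff_const.sub (contDiff_const.mul
      ((contDiff_pi.1 hn i).mul (contDiff_pi.1 hn j))))
  have h3 := h1.mul h2
  have e : (fun x => uniaxial (Circle.exp (φ x)) (n x) i j) = fun x =>
      Complex.exp ((φ x : ℂ) * Complex.I) * (((1 : Matrix (Fin 3) (Fin 3) ℝ) i j -
        3 * (n x i * n x j) : ℝ) : ℂ) := by
    ext x
    simp [uniaxial, toComplex, Circle.coe_exp, Matrix.vecMulVec_apply]
  rw [e]
  exact h3

/-- Spherical coordinates on the sphere. -/
noncomputable def sphericalNormal (θ φ : ℝ) : Fin 3 → ℝ :=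
  ![Real.sin θ * Real.cos φ, Real.sin θ * Real.sin φ, Real.cos θ]

/-- The unit tangent vector of the meridians. -/
noncomputable def meridian (θ φ : ℝ) : Fin 3 → ℝ :=
  ![Real.cos θ * Real.cos φ, Real.cos θ * Real.sin φ, -Real.sin θ]

/-- The points of the orbit with `(m × n)₃ = 0`, in spherical coordinates. -/
noncomputable def criticalChart (c : ℝ) (x : Fin 5 → ℝ) : Triple :=
  (x 0, c • sphericalNormal (x 2) (x 3) + x 4 • meridian (x 2) (x 3),
    uniaxial (Circle.exp (x 1)) (sphericalNormal (x 2) (x 3)))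

/-- The points of the orbit with `n = ε e₃`. -/
noncomputable def polarChart (c ε : ℝ) (x : Fin 4 → ℝ) : Triple :=
  (x 0, ![x 2, x 3, ε * c], uniaxial (Circle.exp (x 1)) ![0, 0, ε])

theorem contDiff_criticalChart (c : ℝ) : ContDiff ℝ 1 (criticalChart c) := by
  have h : ∀ i : Fin 5, ContDiff ℝ 1 fun x : Fin 5 → ℝ => x i := fun i => contDiff_apply ℝ ℝ i
  have hs : ContDiff ℝ 1 fun x : Fin 5 → ℝ => sphericalNormal (x 2) (x 3) := by
    refine contDiff_pi.2 fun i => ?_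
    fin_cases i
    exacts [(h 2).sin.mul (h 3).cos, (h 2).sin.mul (h 3).sin, (h 2).cos]
  have hm : ContDiff ℝ 1 fun x : Fin 5 → ℝ => meridian (x 2) (x 3) := by
    refine contDiff_pi.2 fun i => ?_
    fin_cases i
    exacts [(h 2).cos.mul (h 3).cos, (h 2).cos.mul (h 3).sin, (h 2).sin.neg]
  exact (h 0).prodMk (((hs.const_smul c).add ((h 4).smul hm)).prodMk
    (contDiff_uniaxial (h 1) hs))

theorem contDiff_polarChart (c ε : ℝ) : ContDiff ℝ 1 (polarChart c ε) := by
  have h : ∀ i : Fin 4, ContDiff ℝ 1 fun x : Fin 4 → ℝ => x i := fun i => contDiff_apply ℝ ℝ i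
  have hm : ContDiff ℝ 1 fun x : Fin 4 → ℝ => ![x 2, x 3, ε * c] := by
    refine contDiff_pi.2 fun i => ?_
    fin_cases i
    exacts [h 2, h 3, contDiff_const]
  exact (h 0).prodMk (hm.prodMk (contDiff_uniaxial (h 1) contDiff_const))

/-- Off the poles, (m × n)₃ = 0 says that m lies in the meridian plane spanned by n and e₃, which
leaves one free momentum parameter. At a pole the condition is empty, but n is fixed. -/
theorem critical_subset (p : ℝ) (m : Fin 3 → ℝ) :
    coadOrbit (p, m, baseMat) \ {z | axialTorqueSq z ≠ 0} ⊆
      Set.range (criticalChart (m 2)) ∪ (Set.range (polarChart (m 2) 1) ∪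
        Set.range (polarChart (m 2) (-1))) := by
  rintro z ⟨hz, hk⟩
  obtain ⟨u, n, hn, hm, hA⟩ := mem_coadOrbit_iff.1 hz
  rw [Set.mem_ofPred_eq, not_not, axialTorqueSq_eq hn hA, sq_eq_zero_iff, cross_apply_two] at hk
  simp only [dotProduct, Fin.sum_univ_three] at hn hm
  have hu : Circle.exp (Complex.arg u) = u := Circle.exp_arg u
  by_cases h01 : n 0 ^ 2 + n 1 ^ 2 = 0
  · right
    have n0 : n 0 = 0 := by nlinarith [sq_nonneg (n 0), sq_nonneg (n 1)]
    have n1 : n 1 = 0 := by nlinarith [sq_nonneg (n 0), sq_nonneg (n 1)]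
    have key : ∀ ε : ℝ, ε * ε = 1 → n 2 = ε → z ∈ Set.range (polarChart (m 2) ε) := by
      intro ε hε hn2
      have hn3 : n = ![0, 0, ε] := by
        ext i
        fin_cases i <;> simp [n0, n1, hn2]
      refine ⟨![z.1, Complex.arg u, z.2.1 0, z.2.1 1], ?_⟩
      refine Prod.ext rfl (Prod.ext ?_ ?_)
      · ext i
        fin_cases i <;> simp [polarChart]
        rw [n0, n1, hn2] at hm
        linear_combination (-ε) * hm + z.2.1 2 * hε
      · simp [polarChart, hu, hA, hn3]
    rw [n0, n1] at hn
    rcases mul_self_eq_one_iff.1 (show n 2 * n 2 = 1 by linarith) with h | h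
    · exact Or.inl (key 1 (by norm_num) h)
    · exact Or.inr (key (-1) (by norm_num) h)
  · left
    have hpos : 0 < n 0 ^ 2 + n 1 ^ 2 := lt_of_le_of_ne (by positivity) (Ne.symm h01)
    set r := Real.sqrt (n 0 ^ 2 + n 1 ^ 2) with hr
    have hr0 : r ≠ 0 := (Real.sqrt_pos.2 hpos).ne'
    have hr2 : r ^ 2 = n 0 ^ 2 + n 1 ^ 2 := Real.sq_sqrt hpos.le
    obtain ⟨θ, hθ1, hθ2⟩ := exists_angle (x := n 2) (y := r) (by rw [hr2]; linarith)
    obtain ⟨φ, hφ1, hφ2⟩ := exists_angle (x := n 0 / r) (y := n 1 / r) (by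
      rw [div_pow, div_pow, ← add_div, ← hr2, div_self (pow_ne_zero 2 hr0)])
    rw [div_eq_iff hr0, hθ2, mul_comm] at hφ1 hφ2
    have hsn : n = sphericalNormal θ φ := by
      ext i
      fin_cases i <;> simp [sphericalNormal, hφ1, hφ2, hθ1]
    have hk' : z.2.1 0 * Real.sin φ = z.2.1 1 * Real.cos φ := by
      rw [hφ1, hφ2] at hk
      rw [hθ2] at hr0
      refine mul_left_cancel₀ hr0 ?_
      linear_combination hk
    rw [hφ1, hφ2, hθ1] at hm
    have s1 := Real.sin_sq_add_cos_sq θ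
    have s2 := Real.sin_sq_add_cos_sq φ
    refine ⟨![z.1, Complex.arg u, θ, φ, z.2.1 ⬝ᵥ meridian θ φ], ?_⟩
    refine Prod.ext rfl (Prod.ext ?_ ?_)
    · simp only [dotProduct, Fin.sum_univ_three]
      ext i
      fin_cases i <;> simp [criticalChart, sphericalNormal, meridian, ← hm]
      · linear_combination (z.2.1 0 * Real.cos φ ^ 2 + z.2.1 1 * Real.sin φ * Real.cos φ) * s1 +
          z.2.1 0 * s2 - Real.sin φ * hk'
      · linear_combination (z.2.1 0 * Real.cos φ * Real.sin φ + z.2.1 1 * Real.sin φ ^ 2) * s1 +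
          z.2.1 1 * s2 + Real.cos φ * hk'
      · linear_combination z.2.1 2 * s1
    · simp [criticalChart, hu, hA, hsn]

/-- A C¹ image of ℝᵏ has Hausdorff dimension at most k, so the covering charts give dimension at
most 5 < 6. -/
theorem hausdorffVolume_critical (p : ℝ) (m : Fin 3 → ℝ) :
    hausdorffVolume 6 (coadOrbit (p, m, baseMat) \ {z | axialTorqueSq z ≠ 0}) = 0 := by
  let : MeasurableSpace Triple :=
    @borel Triple PseudoEMetricSpace.toUniformSpace.toTopologicalSpace
  have : @BorelSpace Triple PseudoEMetricSpace.toUniformSpace.toTopologicalSpace _ := ⟨rfl⟩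
  have h1 : dimH (Set.range (criticalChart (m 2))) ≤ 5 := by
    simpa using (contDiff_criticalChart (m 2)).dimH_range_le
  have h2 : ∀ ε, dimH (Set.range (polarChart (m 2) ε)) ≤ 5 := fun ε =>
    (contDiff_polarChart (m 2) ε).dimH_range_le.trans (by norm_num)
  have h3 : dimH (coadOrbit (p, m, baseMat) \ {z | axialTorqueSq z ≠ 0}) ≤ 5 := by
    refine (dimH_mono (critical_subset p m)).trans ?_
    rw [dimH_union, dimH_union]
    exact max_le h1 (max_le (h2 _) (h2 _))
  exact hausdorffMeasure_of_dimH_lt (d := 6) (h3.trans_lt (by norm_num))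

end NeutronStar

theorem theorem4p10 (γ₁ γ₂ γ₃ : ℝ) (hγ₁ : 0 < γ₁) (hγ₂ : 0 < γ₂) (hγ₃ : 0 < γ₃)
    (p : ℝ) (m : Fin 3 → ℝ) :
    (∀ z ∈ NeutronStar.coadOrbit (p, m, NeutronStar.baseMat),
      ∃! ξ : ℝ × (Fin 3 → ℝ), NeutronStar.IsVelocity ![γ₁, γ₂, γ₃] z ξ) ∧
    NeutronStar.IsCompletelyIntegrable (n := 3)
      (NeutronStar.coadOrbit (p, m, NeutronStar.baseMat))
      ![NeutronStar.hamiltonian ![γ₁, γ₂, γ₃],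
        NeutronStar.circleMomentum ![γ₁, γ₂, γ₃],
        NeutronStar.rotationMomentum] := by
  have hg : 0 < (![γ₁, γ₂, γ₃] : Fin 3 → ℝ) 0 := hγ₁
  have hd : 0 < (![γ₁, γ₂, γ₃] : Fin 3 → ℝ) 1 + (![γ₁, γ₂, γ₃] : Fin 3 → ℝ) 2 :=
    add_pos hγ₂ hγ₃
  refine ⟨fun z hz => ?_, ?_, ?_, ?_, ?_⟩
  · obtain ⟨u, n, hn, -, hA⟩ := NeutronStar.mem_coadOrbit_iff.1 hz
    exact NeutronStar.existsUnique_isVelocity hg hd hn hA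
  · exact fun z hz => NeutronStar.finrank_orbitTangent hz
  · intro i
    fin_cases i
    exacts [NeutronStar.contDiffOn_hamiltonian hg hd p m,
      NeutronStar.contDiffOn_circleMomentum hg hd p m,
      NeutronStar.contDiff_rotationMomentum.contDiffOn]
  · exact fun i j z hz => NeutronStar.involution hg hd i j hz
  · refine ⟨{z | NeutronStar.axialTorqueSq z ≠ 0},
      isOpen_ne_fun NeutronStar.contDiff_axialTorqueSq.continuous continuous_const,
      NeutronStar.coadOrbit_subset_closure p m, ?_, ?_⟩
    · convert NeutronStar.hausdorffVolume_critical p m using 2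
      norm_num
    · rintro z ⟨hz, hk⟩ c h
      refine NeutronStar.differentials_independent hg hd hz hk fun ζ hζ => ?_
      have := h ζ hζ
      rw [Fin.sum_univ_three] at this
      exact this
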